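/- Fix $b>0$. For $\lambda\in(0,1)$ let $\Omega_\lambda=\{x^2/a^2+y^2/b^2<1\}$ be the ellipse with minor semiaxis $b$ and major semiaxis $a=b/\sqrt\lambda$, i.e. with eccentricity $\varepsilon$ given by $\lambda=1-\varepsilon^2=(b/a)^2$. Let $u_\lambda(t,\mathbf r)$ be its local heat content, that is, the bounded classical solution of $\partial_t u=\Delta u$ in $\Omega_\lambda$, $t>0$, with $u=1$ in $\Omega_\lambda$ at $t=0$ and $u=0$ on $\partial\Omega_\lambda$ for $t>0$. Put $$\tilde H_\lambda(s)=\int_0^\infty e^{-s^2t}\,\frac1{|\Omega_\lambda|}\int_{\Omega_\lambda}u_\lambda(t,\mathbf r)\,d\mathbf r\,dt ,\qquad s>0 .$$ Then there are functions $H_0,H_1$ of $s$, not depending on $\lambda$, such that for every fixed $s>0$ $$\tilde H_\lambda(s)=H_0(s)+\lambda H_1(s)+O(\lambda^2),\qquad \lambda\to0^+ ,$$ and these have Weyl series, i.e. asymptotic series as $s\to\infty$ (to all orders in $1/s$), $$H_0(s)\sim\sum_{n\ge2}\frac{c_n^{(0)}}{s^n},\qquad H_1(s)\sim-\frac{2}{\pi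 b}\,\frac{\ln s}{s^3}+\sum_{n\ge2}\frac{c_n^{(1)}}{s^n}.$$ Here $c_2^{(0)}=1$, $c_2^{(1)}=0$, and $c_n^{(0)}=c_n^{(1)}=0$ for every even $n\ge4$, so that besides the term $1/s^2$ only odd powers of $1/s$ occur. As $n\to\infty$ through the odd integers, $$c_n^{(0)}\sim16\sqrt{\frac{2}{\pi^3}}\,\frac{\Gamma(n-\frac72)}{(2b)^{n-2}},\qquad c_n^{(1)}\sim\frac12\cdot16\sqrt{\frac{2}{\pi^3}}\,\frac{\Gamma(n-\frac72)}{(2b)^{n-2}} .$$ In other words, order by order in $\lambda$ through first order, $$c_n\sim\Big[1+\frac\lambda2+O(\lambda^2)\Big]\,16\sqrt{\frac{2}{\pi^3}}\,\frac{\Gamma(n-\frac72)}{(2b)^{n-2}},$$ which is the form $c_n\sim\alpha\,\Gamma(n-\beta+1)/l^{\,n-2}$ with $l=2b$ and $\beta=\frac92$. -/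

import Mathlib

open MeasureTheory Set Filter Topology Asymptotics

/-- The Euclidean plane. -/
abbrev Plane : Type := EuclideanSpace ℝ (Fin 2)

/-- The open elliptic domain centred at the origin with semiaxes `a` and `b`. -/
def ellipseDomain (a b : ℝ) : Set Plane :=
  {x | x 0 ^ 2 / a ^ 2 + x 1 ^ 2 / b ^ 2 < 1}

/-- `u t x` is the local heat content (survival probability at time `t` of a diffusing particle
started at `x` and absorbed at the boundary) of the domain `Ω`: the bounded classical solution of
the heat equation in `Ω` with initial temperature `1` and zero boundary temperature. The initial
and boundary data disagree on `frontier Ω` at time `0`, so continuity is not required there. -/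
structure IsLocalHeatContent (Ω : Set Plane) (u : ℝ → Plane → ℝ) : Prop where
  contDiffOn : ContDiffOn ℝ 2 (fun p : ℝ × Plane => u p.1 p.2) (Ioi 0 ×ˢ Ω)
  heat_eq : ∀ t > 0, ∀ x ∈ Ω,
    HasDerivAt (fun τ => u τ x) (Laplacian.laplacian (u t) x) t
  continuousOn : ContinuousOn (fun p : ℝ × Plane => u p.1 p.2)
    ((Ici 0 ×ˢ closure Ω) \ ({0} ×ˢ frontier Ω))
  initial : ∀ x ∈ Ω, u 0 x = 1
  boundary : ∀ t > 0, ∀ x ∈ frontier Ω, u t x = 0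
  bounded : ∃ M : ℝ, ∀ t ≥ 0, ∀ x ∈ Ω, |u t x| ≤ M

/-- The normalized heat content at time `t`: the average over `Ω` of the local heat content. -/
noncomputable def heatContent (Ω : Set Plane) (u : ℝ → Plane → ℝ) (t : ℝ) : ℝ :=
  ⨍ x in Ω, u t x ∂volume

/-- The Laplace transform of the heat content, in the variable `s` with `s ^ 2` dual to `t`. -/
noncomputable def laplaceHeatContent (Ω : Set Plane) (u : ℝ → Plane → ℝ) (s : ℝ) : ℝ :=
  ∫ t in Ioi (0 : ℝ), Real.exp (-(s ^ 2 * t)) * heatContent Ω u t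

/-- `F s ∼ ∑_{n ≥ 2} c n / s ^ n` as `s → ∞`, as an asymptotic (in general divergent) series. -/
def HasWeylSeries (F : ℝ → ℝ) (c : ℕ → ℝ) : Prop :=
  ∀ N : ℕ, (fun s : ℝ => F s - ∑ n ∈ Finset.Icc 2 N, c n / s ^ n) =o[atTop]
    fun s : ℝ => (s ^ N)⁻¹

/-- The universal high-order form `α Γ(n - β + 1) / l ^ (n - 2)` of Weyl coefficients. -/
noncomputable def weylHighOrder (α β l : ℝ) (n : ℕ) : ℝ :=
  α * Real.Gamma ((n : ℝ) - β + 1) / l ^ ((n : ℤ) - 2)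

/-! The Laplace transform `v` of `u` formally solves `Δ v - s² v = -1` with zero boundary values. In
the stretched variable `ξ = √λ x` the ellipse becomes the disk of radius `b` and the operator
becomes `λ ∂ξ² + ∂y² - s²`, so that `λ → 0` is a regular perturbation of an ODE on the chord `|y| <
h`, `h = √(b² - ξ²)`. With `g = sech (s h)`, order zero is `(1 - g cosh (s y)) / s²` and order one
is `g'' (y sinh (s y) - h tanh (s h) cosh (s y)) / (2 s³)`. Although `h` is singular at the tips `ξ
= ±b`, only even functions of `h` occur, so everything is smooth across the tips (`coshSqrt`). Hence
the two-term solution has residual `O(λ²)` uniformly, and the maximum principle bounds the error by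
`O(λ²)` at fixed `s`.

The maximum principle is applied not to `v` but to its truncation to times in `[ε, T]`, which is
continuous up to the boundary and twice differentiable inside. The price is an error `1 - u ε` in
the equation, not small near the boundary; the barrier `1 - q ^ (k + 2)`, with `q` the quadratic
form of the ellipse, absorbs it (`exists_abs_laplaceTruncation_sub_le`). Letting `ε → 0` and `T → ∞`
gives `abs_laplaceHeatContent_sub_average_le`. Neither existence nor uniqueness of `u` is needed.

Averaging over chords, integrating by parts once in `ξ` and taking `h` as variable gives
(`leadingTerm_eq`, `correctionTerm_eq`) integrals over `0 < h < b` of `h / √(b² - h²)` against `tanh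
(s h)`, and of `√(b² - h²) / h + h / (3 √(b² - h²))` against `tanh³ (s h)`. Writing `tanh = 1 - (1 -
tanh)`, the `1` gives the `1 / s³` terms, the singular part `b / h` of the second weight gives the
logarithm, and Watson's lemma (`isBigO_watson`) handles the rest. The regular weights have only odd
powers of `h`, whence only odd powers of `1 / s`.

The coefficients are thus binomial coefficients of `(1 - x) ^ (-1/2)`, of size `1 / √(π k)`, times
moments of `1 - tanh ~ 2 e^{-2x}` or `1 - tanh³ ~ 6 e^{-2x}`, of size `(2k+1)! / 2^(2k+2)`. The
second weight contributes asymptotically `1/3` of the binomial coefficient, and the prefactors are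
`4` and `2`; so the ratio of the two amplitudes is `(2 · 6 / 3) / (4 · 2) = 1/2`. -/

/-! ### Coordinate Laplacian and the elliptic maximum principle -/

/-- `f` is differentiable near `r`, with second derivative `d` at `r`. -/
def HasSecondDerivAt (f : ℝ → ℝ) (d r : ℝ) : Prop :=
  ∃ f' : ℝ → ℝ, (∀ᶠ ρ in 𝓝 r, HasDerivAt f (f' ρ) ρ) ∧ HasDerivAt f' d r

namespace HasSecondDerivAt

variable {f g : ℝ → ℝ} {d e r : ℝ}

theorem add (hf : HasSecondDerivAt f d r) (hg : HasSecondDerivAt g e r) :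
    HasSecondDerivAt (fun ρ => f ρ + g ρ) (d + e) r := by
  obtain ⟨f', hf', hf''⟩ := hf
  obtain ⟨g', hg', hg''⟩ := hg
  refine ⟨fun ρ => f' ρ + g' ρ, ?_, hf''.add hg''⟩
  filter_upwards [hf', hg'] with ρ h1 h2 using h1.add h2

theorem const_mul (c : ℝ) (hf : HasSecondDerivAt f d r) :
    HasSecondDerivAt (fun ρ => c * f ρ) (c * d) r := by
  obtain ⟨f', hf', hf''⟩ := hf
  refine ⟨fun ρ => c * f' ρ, ?_, hf''.const_mul c⟩
  filter_upwards [hf'] with ρ h1 using h1.const_mul c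

theorem const (c : ℝ) : HasSecondDerivAt (fun _ => c) 0 r :=
  ⟨fun _ => 0, .of_forall fun _ => hasDerivAt_const _ _, hasDerivAt_const _ _⟩

/-- If `d` were positive, the second derivative test would make the maximum also a local minimum;
then `f` is locally constant and `d = 0`. -/
theorem nonpos_of_isLocalMax (hf : HasSecondDerivAt f d r) (hmax : IsLocalMax f r) : d ≤ 0 := by
  obtain ⟨f', hf', hf''⟩ := hf
  by_contra! hd
  have hderiv : deriv f =ᶠ[𝓝 r] f' := by filter_upwards [hf'] with ρ h using h.deriv
  have hdd : deriv (deriv f) r = d := by rw [hderiv.deriv_eq]; exact hf''.deriv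
  have hmin : IsLocalMin f r := by
    refine isLocalMin_of_deriv_deriv_pos (by rwa [hdd]) hmax.deriv_eq_zero ?_
    exact hf'.self_of_nhds.continuousAt
  have hconst : f =ᶠ[𝓝 r] fun _ => f r := by
    filter_upwards [hmax, hmin] with ρ h1 h2 using le_antisymm h1 h2
  have h0 : deriv f =ᶠ[𝓝 r] fun _ => 0 := by
    have := hconst.deriv
    simpa using this
  have : deriv (deriv f) r = 0 := by rw [h0.deriv_eq]; simp
  linarith

end HasSecondDerivAt

/-- `f` has second derivatives along both coordinate lines through `x`, and their sum is `L`. -/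
def HasCoordLaplacianAt (f : Plane → ℝ) (L : ℝ) (x : Plane) : Prop :=
  ∃ d : Fin 2 → ℝ,
    (∀ i, HasSecondDerivAt (fun r : ℝ => f (x + r • EuclideanSpace.single i (1 : ℝ))) (d i) 0) ∧
      ∑ i, d i = L

namespace HasCoordLaplacianAt

variable {f g : Plane → ℝ} {L M : ℝ} {x : Plane}

theorem add (hf : HasCoordLaplacianAt f L x) (hg : HasCoordLaplacianAt g M x) :
    HasCoordLaplacianAt (fun y => f y + g y) (L + M) x := by
  obtain ⟨d, hd, rfl⟩ := hf
  obtain ⟨e, he, rfl⟩ := hg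
  exact ⟨fun i => d i + e i, fun i => (hd i).add (he i), Finset.sum_add_distrib⟩

theorem const_mul (c : ℝ) (hf : HasCoordLaplacianAt f L x) :
    HasCoordLaplacianAt (fun y => c * f y) (c * L) x := by
  obtain ⟨d, hd, rfl⟩ := hf
  exact ⟨fun i => c * d i, fun i => (hd i).const_mul c, (Finset.mul_sum _ _ _).symm⟩

theorem const (c : ℝ) : HasCoordLaplacianAt (fun _ => c) 0 x :=
  ⟨fun _ => 0, fun _ => .const c, by simp⟩

theorem nonpos_of_isLocalMax (hf : HasCoordLaplacianAt f L x) (hmax : IsLocalMax f x) :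
    L ≤ 0 := by
  obtain ⟨d, hd, rfl⟩ := hf
  refine Finset.sum_nonpos fun i _ => (hd i).nonpos_of_isLocalMax ?_
  have hc : Tendsto (fun r : ℝ => x + r • EuclideanSpace.single i (1 : ℝ)) (𝓝 0) (𝓝 x) := by
    have : Continuous fun r : ℝ => x + r • EuclideanSpace.single i (1 : ℝ) := by fun_prop
    simpa using this.tendsto 0
  have := hc.eventually hmax
  simpa [IsLocalMax, IsMaxFilter] using this

end HasCoordLaplacianAt

/-- Maximum principle: a subsolution of `Δ f = s ^ 2 f` that is nonpositive on the boundary is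
nonpositive. -/
theorem nonpos_of_subsolution {Ω K : Set Plane} (hΩ : IsOpen Ω) (hK : IsCompact K) (hΩK : Ω ⊆ K)
    {f : Plane → ℝ} (hf : ContinuousOn f K) (hbd : ∀ x ∈ K \ Ω, f x ≤ 0) {s : ℝ} (hs : 0 < s)
    {L : Plane → ℝ} (hL : ∀ x ∈ Ω, HasCoordLaplacianAt f (L x) x)
    (hsub : ∀ x ∈ Ω, s ^ 2 * f x ≤ L x) : ∀ x ∈ K, f x ≤ 0 := by
  intro x hx
  obtain ⟨z, hz, hmax⟩ := hK.exists_isMaxOn ⟨x, hx⟩ hf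
  refine (hmax hx).trans ?_
  by_cases hzΩ : z ∈ Ω
  · have hloc : IsLocalMax f z := by
      filter_upwards [hΩ.mem_nhds hzΩ] with y hy using hmax (hΩK hy)
    have h1 := (hL z hzΩ).nonpos_of_isLocalMax hloc
    have h2 := hsub z hzΩ
    by_contra! h3
    have : 0 < s ^ 2 * f z := by positivity
    linarith
  · exact hbd z ⟨hz, hzΩ⟩

/-! ### Time integrals of the local heat content -/

/-- Since `ε > 0`, the set `[ε, T]` times a short closed segment is a compact subset of the region
of smoothness, so the integrand's derivative has a constant dominating bound. It serves for `u` and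
again for its first derivatives. -/
theorem hasDerivAt_integral_along_line {Ω : Set Plane} (hΩ : IsOpen Ω) {F : ℝ × Plane → ℝ}
    (hF : ContDiffOn ℝ 1 F (Ioi 0 ×ˢ Ω)) {g : ℝ → ℝ} (hg : Continuous g) {ε T : ℝ} (hε : 0 < ε)
    (hT : ε ≤ T) (x e : Plane) {r : ℝ} (hr : x + r • e ∈ Ω) :
    HasDerivAt (fun ρ : ℝ => ∫ τ in ε..T, g τ * F (τ, x + ρ • e))
      (∫ τ in ε..T, g τ * fderiv ℝ F (τ, x + r • e) (0, e)) r := by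
  have hO : IsOpen (Ioi (0 : ℝ) ×ˢ Ω) := isOpen_Ioi.prod hΩ
  have hline : Continuous fun ρ : ℝ => x + ρ • e := by fun_prop
  obtain ⟨δ, hδ, hball⟩ := Metric.nhds_basis_closedBall.mem_iff.1
    ((hΩ.preimage hline).mem_nhds hr)
  have hmem : ∀ τ ∈ Icc ε T, ∀ ρ ∈ Metric.closedBall r δ, (τ, x + ρ • e) ∈ Ioi (0 : ℝ) ×ˢ Ω :=
    fun τ hτ ρ hρ => ⟨hε.trans_le hτ.1, hball hρ⟩
  have hfd : ContinuousOn (fun q => fderiv ℝ F q (0, e)) (Ioi (0 : ℝ) ×ˢ Ω) :=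
    (hF.continuousOn_fderiv_of_isOpen hO le_rfl).clm_apply continuousOn_const
  have hmap : Continuous fun q : ℝ × ℝ => (q.1, x + q.2 • e) := by fun_prop
  obtain ⟨C, hC⟩ := (isCompact_Icc.prod (isCompact_closedBall r δ)).exists_bound_of_continuousOn
    (f := fun q : ℝ × ℝ => g q.1 * fderiv ℝ F (q.1, x + q.2 • e) (0, e))
    (s := Icc ε T ×ˢ Metric.closedBall r δ)
    ((hg.comp continuous_fst).continuousOn.mul
      (hfd.comp hmap.continuousOn fun q hq => hmem _ hq.1 _ hq.2))
  have hι : uIoc ε T ⊆ Icc ε T := by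
    rw [uIoc_of_le hT]; exact Ioc_subset_Icc_self
  have hcF : ∀ ρ ∈ Metric.closedBall r δ,
      ContinuousOn (fun τ => g τ * F (τ, x + ρ • e)) (Icc ε T) := fun ρ hρ =>
    hg.continuousOn.mul (hF.continuousOn.comp (by fun_prop) fun τ hτ => hmem τ hτ ρ hρ)
  have hcF' : ContinuousOn (fun τ => g τ * fderiv ℝ F (τ, x + r • e) (0, e)) (Icc ε T) :=
    hg.continuousOn.mul (hfd.comp (by fun_prop)
      fun τ hτ => hmem τ hτ r (Metric.mem_closedBall_self hδ.le))
  have hball' : Metric.closedBall r δ ∈ 𝓝 r := Metric.closedBall_mem_nhds r hδ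
  refine (intervalIntegral.hasDerivAt_integral_of_dominated_loc_of_deriv_le (bound := fun _ => C)
    (F' := fun ρ τ => g τ * fderiv ℝ F (τ, x + ρ • e) (0, e)) hball' ?_ ?_ ?_ ?_ ?_ ?_).2
  · filter_upwards [hball'] with ρ hρ
    exact ((hcF ρ hρ).mono hι).aestronglyMeasurable measurableSet_uIoc
  · exact ContinuousOn.intervalIntegrable
      (by rw [uIcc_of_le hT]; exact hcF r (Metric.mem_closedBall_self hδ.le))
  · exact (hcF'.mono hι).aestronglyMeasurable measurableSet_uIoc
  · exact .of_forall fun τ hτ ρ hρ => hC (τ, ρ) ⟨hι hτ, hρ⟩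
  · exact intervalIntegrable_const
  · refine .of_forall fun τ hτ ρ hρ => HasDerivAt.const_mul _ ?_
    have hd : HasFDerivAt F (fderiv ℝ F (τ, x + ρ • e)) (τ, x + ρ • e) :=
      ((hF.differentiableOn one_ne_zero).differentiableAt
        (hO.mem_nhds (hmem τ (hι hτ) ρ hρ))).hasFDerivAt
    have hl : HasDerivAt (fun ρ : ℝ => (τ, x + ρ • e)) (0, e) ρ := by
      refine (hasDerivAt_const ρ τ).prodMk ?_
      simpa using ((hasDerivAt_id ρ).smul_const e).const_add x
    exact hd.comp_hasDerivAt ρ hl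

/-- Links the Laplacian of a time slice, in which the heat equation is stated, to derivatives of the
joint function of `(t, x)`, which can be taken under the time integral. -/
theorem laplacian_eq_sum_fderiv_of_contDiffOn {Ω : Set Plane} (hΩ : IsOpen Ω)
    {u : ℝ → Plane → ℝ}
    (hu : ContDiffOn ℝ 2 (fun p : ℝ × Plane => u p.1 p.2) (Ioi 0 ×ˢ Ω)) {t : ℝ} (ht : 0 < t)
    {x : Plane} (hx : x ∈ Ω) :
    Laplacian.laplacian (u t) x = ∑ i, fderiv ℝ (fun q => fderiv ℝ
      (fun p : ℝ × Plane => u p.1 p.2) q (0, EuclideanSpace.single i (1 : ℝ))) (t, x)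
        (0, EuclideanSpace.single i 1) := by
  have hO : IsOpen (Ioi (0 : ℝ) ×ˢ Ω) := isOpen_Ioi.prod hΩ
  rw [InnerProductSpace.laplacian_eq_iteratedFDeriv_orthonormalBasis _
    (EuclideanSpace.basisFun (Fin 2) ℝ)]
  refine Finset.sum_congr rfl fun i _ => ?_
  set e : Plane := EuclideanSpace.single i (1 : ℝ) with he
  set U : ℝ × Plane → ℝ := fun p => u p.1 p.2
  have hU1 : ∀ y ∈ Ω, HasFDerivAt (u t)
      ((fderiv ℝ U (t, y)).comp (ContinuousLinearMap.inr ℝ ℝ Plane)) y := fun y hy =>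
    (((hu.differentiableOn two_ne_zero).differentiableAt
      (hO.mem_nhds (mk_mem_prod ht hy))).hasFDerivAt).comp y (hasFDerivAt_prodMk_right t y)
  have hfd : fderiv ℝ (u t) =ᶠ[𝓝 x]
      fun y => (fderiv ℝ U (t, y)).comp (ContinuousLinearMap.inr ℝ ℝ Plane) := by
    filter_upwards [hΩ.mem_nhds hx] with y hy using (hU1 y hy).fderiv
  have hD : DifferentiableAt ℝ (fderiv ℝ U) (t, x) :=
    ((hu.fderiv_of_isOpen hO (m := 1) (by norm_num)).differentiableOn one_ne_zero).differentiableAt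
      (hO.mem_nhds (mk_mem_prod ht hx))
  rw [iteratedFDeriv_two_apply, hfd.fderiv_eq]
  have h1 : HasFDerivAt (fun y => fderiv ℝ U (t, y))
      ((fderiv ℝ (fderiv ℝ U) (t, x)).comp (ContinuousLinearMap.inr ℝ ℝ Plane)) x :=
    hD.hasFDerivAt.comp x (hasFDerivAt_prodMk_right t x)
  have h2 := h1.clm_comp (hasFDerivAt_const (ContinuousLinearMap.inr ℝ ℝ Plane) x)
  have h3 := hD.hasFDerivAt.clm_apply (hasFDerivAt_const ((0 : ℝ), e) (t, x))
  rw [h2.fderiv, h3.fderiv]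
  simp [he]

/-- The Laplacian passes under the integral, the heat equation turns it into `∂τ u`, and integration
by parts in `τ` leaves the two endpoint terms and `s²` times the integral. -/
theorem IsLocalHeatContent.hasCoordLaplacianAt_integral {Ω : Set Plane} (hΩ : IsOpen Ω)
    {u : ℝ → Plane → ℝ} (hu : IsLocalHeatContent Ω u) (s : ℝ) {ε T : ℝ} (hε : 0 < ε)
    (hT : ε ≤ T) {x : Plane} (hx : x ∈ Ω) :
    HasCoordLaplacianAt (fun y => ∫ τ in ε..T, Real.exp (-(s ^ 2 * τ)) * u τ y)
      (Real.exp (-(s ^ 2 * T)) * u T x - Real.exp (-(s ^ 2 * ε)) * u ε x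
        + s ^ 2 * ∫ τ in ε..T, Real.exp (-(s ^ 2 * τ)) * u τ x) x := by
  have hO : IsOpen (Ioi (0 : ℝ) ×ˢ Ω) := isOpen_Ioi.prod hΩ
  set U : ℝ × Plane → ℝ := fun p => u p.1 p.2 with hUdef
  have hU : ContDiffOn ℝ 2 U (Ioi 0 ×ˢ Ω) := hu.contDiffOn
  have hg : Continuous fun τ : ℝ => Real.exp (-(s ^ 2 * τ)) := by fun_prop
  set D : Fin 2 → ℝ × Plane → ℝ :=
    fun i q => fderiv ℝ U q (0, EuclideanSpace.single i (1 : ℝ)) with hDdef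
  have hD : ∀ i, ContDiffOn ℝ 1 (D i) (Ioi 0 ×ˢ Ω) := fun i =>
    (hU.fderiv_of_isOpen hO (m := 1) (by norm_num)).clm_apply contDiffOn_const
  have hDD : ∀ i, ContinuousOn
      (fun q => fderiv ℝ (D i) q (0, EuclideanSpace.single i (1 : ℝ))) (Ioi 0 ×ˢ Ω) := fun i =>
    ((hD i).continuousOn_fderiv_of_isOpen hO le_rfl).clm_apply continuousOn_const
  have hι : ∀ τ ∈ uIcc ε T, (τ, x) ∈ Ioi (0 : ℝ) ×ˢ Ω := fun τ hτ => by
    rw [uIcc_of_le hT] at hτ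
    exact ⟨hε.trans_le hτ.1, hx⟩
  have hcont : ∀ i, ContinuousOn (fun τ => Real.exp (-(s ^ 2 * τ)) *
      fderiv ℝ (D i) (τ, x) (0, EuclideanSpace.single i (1 : ℝ))) (uIcc ε T) := fun i =>
    hg.continuousOn.mul ((hDD i).comp (by fun_prop) hι)
  have hcu : ContinuousOn (fun τ => Real.exp (-(s ^ 2 * τ)) * u τ x) (uIcc ε T) :=
    hg.continuousOn.mul (hU.continuousOn.comp (f := fun τ => (τ, x)) (by fun_prop) hι)
  refine ⟨fun i => ∫ τ in ε..T, Real.exp (-(s ^ 2 * τ)) *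
    fderiv ℝ (D i) (τ, x) (0, EuclideanSpace.single i (1 : ℝ)), fun i => ?_, ?_⟩
  · refine ⟨fun r => ∫ τ in ε..T, Real.exp (-(s ^ 2 * τ)) *
      D i (τ, x + r • EuclideanSpace.single i (1 : ℝ)), ?_, ?_⟩
    · have hline : Continuous fun ρ : ℝ => x + ρ • EuclideanSpace.single i (1 : ℝ) := by fun_prop
      filter_upwards [(hΩ.preimage hline).mem_nhds (x := 0) (by simpa using hx)] with ρ hρ
      exact hasDerivAt_integral_along_line hΩ (hU.of_le one_le_two) hg hε hT x _ hρ
    · have := hasDerivAt_integral_along_line hΩ (hD i) hg hε hT x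
        (EuclideanSpace.single i (1 : ℝ)) (r := 0) (by simpa using hx)
      simpa using this
  · rw [← intervalIntegral.integral_finsetSum fun i _ => (hcont i).intervalIntegrable]
    have hderiv : ∀ τ ∈ uIcc ε T, HasDerivAt (fun τ => Real.exp (-(s ^ 2 * τ)) * u τ x)
        ((∑ i, Real.exp (-(s ^ 2 * τ)) *
          fderiv ℝ (D i) (τ, x) (0, EuclideanSpace.single i (1 : ℝ)))
          - s ^ 2 * (Real.exp (-(s ^ 2 * τ)) * u τ x)) τ := by
      intro τ hτ
      have h1 := hu.heat_eq τ (hι τ hτ).1 x hx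
      rw [laplacian_eq_sum_fderiv_of_contDiffOn hΩ hU (hι τ hτ).1 hx] at h1
      have h2 : HasDerivAt (fun τ : ℝ => Real.exp (-(s ^ 2 * τ)))
          (Real.exp (-(s ^ 2 * τ)) * (-(s ^ 2 * 1))) τ :=
        (((hasDerivAt_id τ).const_mul (s ^ 2)).neg).exp
      refine (h2.mul h1).congr_deriv ?_
      rw [← Finset.mul_sum]
      ring
    have hsum : ContinuousOn (fun τ => ∑ i, Real.exp (-(s ^ 2 * τ)) *
          fderiv ℝ (D i) (τ, x) (0, EuclideanSpace.single i (1 : ℝ))) (uIcc ε T) :=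
      continuousOn_finsetSum _ fun i _ => hcont i
    have hint := intervalIntegral.integral_eq_sub_of_hasDerivAt hderiv
      (hsum.sub (continuousOn_const.mul hcu)).intervalIntegrable
    rw [intervalIntegral.integral_sub hsum.intervalIntegrable
      (hcu.intervalIntegrable.const_mul _), intervalIntegral.integral_const_mul] at hint
    linarith

/-! ### Geometry of the ellipse -/

theorem HasSecondDerivAt.comp_const_mul_add {f : ℝ → ℝ} {d r : ℝ} (c v : ℝ)
    (hf : HasSecondDerivAt f d (v + c * r)) :
    HasSecondDerivAt (fun ρ => f (v + c * ρ)) (c ^ 2 * d) r := by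
  obtain ⟨f', hf', hf''⟩ := hf
  have haff : ∀ ρ, HasDerivAt (fun ρ : ℝ => v + c * ρ) c ρ := fun ρ => by
    simpa using ((hasDerivAt_id ρ).const_mul c).const_add v
  refine ⟨fun ρ => c * f' (v + c * ρ), ?_, ?_⟩
  · filter_upwards [(haff r).continuousAt.eventually hf'] with ρ hρ
    simpa [Function.comp_def, mul_comm] using hρ.comp ρ (haff ρ)
  · have h := (hf''.comp r (haff r)).const_mul c
    rw [show c ^ 2 * d = c * (d * c) by ring]
    exact h

theorem hasCoordLaplacianAt_of_coords {φ : ℝ → ℝ → ℝ} {x : Plane} {d₀ d₁ : ℝ}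
    (h₀ : HasSecondDerivAt (fun r => φ r (x 1)) d₀ (x 0))
    (h₁ : HasSecondDerivAt (fun r => φ (x 0) r) d₁ (x 1)) :
    HasCoordLaplacianAt (fun y => φ (y 0) (y 1)) (d₀ + d₁) x := by
  refine ⟨![d₀, d₁], ?_, by simp⟩
  rw [Fin.forall_fin_two]
  constructor
  · have := HasSecondDerivAt.comp_const_mul_add (r := 0) 1 (x 0) (by simpa using h₀)
    simpa using this
  · have := HasSecondDerivAt.comp_const_mul_add (r := 0) 1 (x 1) (by simpa using h₁)
    simpa using this

/-- The quadratic form whose open unit sublevel set is `ellipseDomain a b`. -/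
noncomputable def ellipseForm (a b : ℝ) (x : Plane) : ℝ := x 0 ^ 2 / a ^ 2 + x 1 ^ 2 / b ^ 2

theorem mem_ellipseDomain {a b : ℝ} {x : Plane} :
    x ∈ ellipseDomain a b ↔ ellipseForm a b x < 1 := Iff.rfl

theorem continuous_ellipseForm (a b : ℝ) : Continuous (ellipseForm a b) := by
  unfold ellipseForm
  fun_prop

theorem ellipseForm_nonneg (a b : ℝ) (x : Plane) : 0 ≤ ellipseForm a b x := by
  unfold ellipseForm
  positivity

theorem isOpen_ellipseDomain (a b : ℝ) : IsOpen (ellipseDomain a b) :=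
  isOpen_lt (continuous_ellipseForm a b) continuous_const

theorem closure_ellipseDomain (a b : ℝ) :
    closure (ellipseDomain a b) = {x | ellipseForm a b x ≤ 1} := by
  apply Subset.antisymm
  · exact closure_minimal (fun x hx => (mem_ellipseDomain.1 hx).le)
      (isClosed_le (continuous_ellipseForm a b) continuous_const)
  -- The form is homogeneous of degree two, so `t • x` with `t < 1` approaches `x` from inside.
  · intro x hx
    have ht : Tendsto (fun t : ℝ => t • x) (𝓝[<] 1) (𝓝 x) := by
      have : Continuous fun t : ℝ => t • x := by fun_prop
      simpa using (this.tendsto 1).mono_left nhdsWithin_le_nhds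
    refine mem_closure_of_tendsto ht ?_
    filter_upwards [Ioo_mem_nhdsLT (show (0 : ℝ) < 1 by norm_num)] with t ht
    have h1 : ellipseForm a b (t • x) = t ^ 2 * ellipseForm a b x := by
      simp only [ellipseForm, PiLp.smul_apply, smul_eq_mul]
      ring
    rw [mem_ellipseDomain, h1]
    have h2 : t ^ 2 < 1 := by nlinarith [ht.1, ht.2]
    have h3 : ellipseForm a b x ≤ 1 := hx
    nlinarith [sq_nonneg t]

theorem frontier_ellipseDomain (a b : ℝ) :
    frontier (ellipseDomain a b) = {x | ellipseForm a b x = 1} := by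
  rw [frontier, closure_ellipseDomain, (isOpen_ellipseDomain a b).interior_eq]
  ext x
  simp only [Set.mem_sdiff, mem_ofPred_eq, mem_ellipseDomain, not_lt]
  exact ⟨fun h => le_antisymm h.1 h.2, fun h => ⟨h.le, h.ge⟩⟩

theorem isCompact_ellipseForm_le {a b : ℝ} (ha : 0 < a) (hb : 0 < b) {ρ : ℝ} (hρ : ρ ≤ 1) :
    IsCompact {x | ellipseForm a b x ≤ ρ} := by
  refine Metric.isCompact_of_isClosed_isBounded
    (isClosed_le (continuous_ellipseForm a b) continuous_const) ?_
  refine (Metric.isBounded_closedBall (x := (0 : Plane)) (r := √(a ^ 2 + b ^ 2))).subset ?_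
  intro x hx
  have hx : x 0 ^ 2 / a ^ 2 + x 1 ^ 2 / b ^ 2 ≤ ρ := hx
  have h0 : x 0 ^ 2 / a ^ 2 ≤ 1 := by
    have : 0 ≤ x 1 ^ 2 / b ^ 2 := by positivity
    linarith
  have h1 : x 1 ^ 2 / b ^ 2 ≤ 1 := by
    have : 0 ≤ x 0 ^ 2 / a ^ 2 := by positivity
    linarith
  rw [div_le_one (by positivity)] at h0 h1
  rw [mem_closedBall_zero_iff, EuclideanSpace.norm_eq, Fin.sum_univ_two]
  refine Real.sqrt_le_sqrt ?_
  simp only [Real.norm_eq_abs, sq_abs]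
  linarith

theorem isCompact_closure_ellipseDomain {a b : ℝ} (ha : 0 < a) (hb : 0 < b) :
    IsCompact (closure (ellipseDomain a b)) := by
  rw [closure_ellipseDomain]
  exact isCompact_ellipseForm_le ha hb le_rfl

theorem volume_ellipseDomain_ne_top {a b : ℝ} (ha : 0 < a) (hb : 0 < b) :
    volume (ellipseDomain a b) ≠ ⊤ :=
  measure_ne_top_of_subset subset_closure
    (isCompact_closure_ellipseDomain ha hb).measure_lt_top.ne

theorem volume_real_ellipseDomain_pos {a b : ℝ} (ha : 0 < a) (hb : 0 < b) :
    0 < volume.real (ellipseDomain a b) := by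
  refine ENNReal.toReal_pos ?_ (volume_ellipseDomain_ne_top ha hb)
  exact ((isOpen_ellipseDomain a b).measure_pos volume
    ⟨0, by simp [ellipseDomain]⟩).ne'

/-- Ingredient of the barrier: the first term grows like `k²` near the boundary. The exponent `k +
2` avoids truncated subtraction in the derivatives. -/
theorem hasCoordLaplacianAt_ellipseForm_pow {a b : ℝ} (k : ℕ) (x : Plane) :
    HasCoordLaplacianAt (fun y => ellipseForm a b y ^ (k + 2))
      ((k + 2) * (k + 1) * ellipseForm a b x ^ k * (4 * x 0 ^ 2 / a ^ 4 + 4 * x 1 ^ 2 / b ^ 4)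
        + (k + 2) * ellipseForm a b x ^ (k + 1) * (2 / a ^ 2 + 2 / b ^ 2)) x := by
  have key : ∀ A C r : ℝ, HasSecondDerivAt (fun ρ => (ρ ^ 2 / A + C) ^ (k + 2))
      ((k + 2) * (k + 1) * (r ^ 2 / A + C) ^ k * (4 * r ^ 2 / A ^ 2)
        + (k + 2) * (r ^ 2 / A + C) ^ (k + 1) * (2 / A)) r := by
    intro A C r
    have h1 : ∀ ρ : ℝ, HasDerivAt (fun ρ : ℝ => ρ ^ 2 / A + C) (2 * ρ / A) ρ := fun ρ => by
      simpa using ((hasDerivAt_pow 2 ρ).div_const A).add_const C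
    refine ⟨fun ρ => (k + 2) * (ρ ^ 2 / A + C) ^ (k + 1) * (2 * ρ / A),
      .of_forall fun ρ => ?_, ?_⟩
    · simpa using (h1 ρ).fun_pow (k + 2)
    · have h2 : HasDerivAt (fun ρ : ℝ => 2 * ρ / A) (2 / A) r := by
        simpa using ((hasDerivAt_id r).const_mul 2).div_const A
      have h3 := (((h1 r).fun_pow (k + 1)).const_mul ((k : ℝ) + 2)).mul h2
      refine h3.congr_deriv ?_
      simp
      ring
  have h := hasCoordLaplacianAt_of_coords (x := x)
    (φ := fun p q => (p ^ 2 / a ^ 2 + q ^ 2 / b ^ 2) ^ (k + 2)) (key (a ^ 2) (x 1 ^ 2 / b ^ 2) (x 0))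
    (by simpa [add_comm] using key (b ^ 2) (x 0 ^ 2 / a ^ 2) (x 1))
  unfold ellipseForm
  convert h using 1
  ring

theorem abs_setAverage_le {Ω : Set Plane} (hΩ : volume Ω ≠ ⊤)
    (hpos : 0 < volume.real Ω) {f : Plane → ℝ} {C : ℝ} (hf : ∀ x ∈ Ω, |f x| ≤ C) :
    |⨍ x in Ω, f x| ≤ C := by
  rw [setAverage_eq, smul_eq_mul, abs_mul, abs_of_pos (inv_pos.2 hpos), inv_mul_le_iff₀ hpos,
    mul_comm]
  exact norm_setIntegral_le_of_norm_le_const (f := f) hΩ.lt_top hf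

/-! ### The Laplace transform and approximate solutions of the elliptic problem -/

/-- Approximation of the Laplace transform of the local heat content at a point. -/
noncomputable def laplaceTruncation (u : ℝ → Plane → ℝ) (s ε T : ℝ) (x : Plane) : ℝ :=
  ∫ τ in ε..T, Real.exp (-(s ^ 2 * τ)) * u τ x

namespace IsLocalHeatContent

variable {a b : ℝ} {u : ℝ → Plane → ℝ}

theorem continuousOn_laplaceTruncation (ha : 0 < a) (hb : 0 < b)
    (hu : IsLocalHeatContent (ellipseDomain a b) u) (s : ℝ) {ε T : ℝ} (hε : 0 < ε) (hT : ε ≤ T) :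
    ContinuousOn (laplaceTruncation u s ε T) (closure (ellipseDomain a b)) := by
  have hsub : Icc ε T ×ˢ closure (ellipseDomain a b) ⊆
      (Ici 0 ×ˢ closure (ellipseDomain a b)) \ ({0} ×ˢ frontier (ellipseDomain a b)) := by
    rintro ⟨t, x⟩ ⟨ht, hx⟩
    refine ⟨⟨hε.le.trans ht.1, hx⟩, fun h => ?_⟩
    have : t = 0 := h.1
    linarith [ht.1]
  have hc : ContinuousOn (fun p : ℝ × Plane => Real.exp (-(s ^ 2 * p.1)) * u p.1 p.2)
      (Icc ε T ×ˢ closure (ellipseDomain a b)) :=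
    ContinuousOn.mul (by fun_prop) (hu.continuousOn.mono hsub)
  obtain ⟨C, hC⟩ := (isCompact_Icc.prod
    (isCompact_closure_ellipseDomain ha hb)).exists_bound_of_continuousOn hc
  have hι : uIoc ε T ⊆ Icc ε T := by
    rw [uIoc_of_le hT]; exact Ioc_subset_Icc_self
  intro x hx
  refine intervalIntegral.continuousWithinAt_of_dominated_interval (bound := fun _ => C) ?_ ?_
    intervalIntegrable_const ?_
  · filter_upwards [self_mem_nhdsWithin] with y hy
    exact ContinuousOn.aestronglyMeasurable (hc.comp (f := fun t : ℝ => (t, y)) (by fun_prop)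
      fun t ht => ⟨hι ht, hy⟩) measurableSet_uIoc
  · filter_upwards [self_mem_nhdsWithin] with y hy
    exact .of_forall fun t ht => hC (t, y) ⟨hι ht, hy⟩
  · exact .of_forall fun t ht => (hc.comp (f := fun y : Plane => (t, y)) (by fun_prop)
      fun y hy => ⟨hι ht, hy⟩) x hx

theorem laplaceTruncation_eq_zero (hu : IsLocalHeatContent (ellipseDomain a b) u) (s : ℝ)
    {ε T : ℝ} (hε : 0 < ε) (hT : ε ≤ T) {x : Plane} (hx : x ∈ frontier (ellipseDomain a b)) :
    laplaceTruncation u s ε T x = 0 := by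
  unfold laplaceTruncation
  rw [intervalIntegral.integral_congr (g := fun _ => 0), intervalIntegral.integral_zero]
  intro t ht
  rw [uIcc_of_le hT] at ht
  simp [hu.boundary t (hε.trans_le ht.1) x hx]

theorem exists_bound (hu : IsLocalHeatContent (ellipseDomain a b) u) :
    ∃ M, 0 ≤ M ∧ ∀ t ≥ 0, ∀ x ∈ ellipseDomain a b, |u t x| ≤ M := by
  obtain ⟨M, hM⟩ := hu.bounded
  exact ⟨|M|, abs_nonneg M, fun t ht x hx => (hM t ht x hx).trans (le_abs_self M)⟩

theorem exists_uniform_initial (ha : 0 < a) (hb : 0 < b)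
    (hu : IsLocalHeatContent (ellipseDomain a b) u) {ρ δ : ℝ} (hρ : ρ < 1) (hδ : 0 < δ) :
    ∃ ε₀ > 0, ∀ ε, 0 < ε → ε < ε₀ → ∀ x, ellipseForm a b x ≤ ρ → |u ε x - 1| < δ := by
  have hsub : Icc (0 : ℝ) 1 ×ˢ {x | ellipseForm a b x ≤ ρ} ⊆
      (Ici 0 ×ˢ closure (ellipseDomain a b)) \ ({0} ×ˢ frontier (ellipseDomain a b)) := by
    rintro ⟨t, x⟩ ⟨ht, hx⟩
    have hx : ellipseForm a b x ≤ ρ := hx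
    refine ⟨⟨ht.1, ?_⟩, fun h => ?_⟩
    · rw [closure_ellipseDomain]
      exact hx.trans hρ.le
    · rw [frontier_ellipseDomain] at h
      have : ellipseForm a b x = 1 := h.2
      linarith
  have huc := (isCompact_Icc.prod (isCompact_ellipseForm_le ha hb
    hρ.le)).uniformContinuousOn_of_continuous (hu.continuousOn.mono hsub)
  obtain ⟨ε₀, hε₀, h⟩ := Metric.uniformContinuousOn_iff.1 huc δ hδ
  refine ⟨min ε₀ 1, by positivity, fun ε hε hεlt x hx => ?_⟩
  have hlt := lt_min_iff.1 hεlt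
  have := h (ε, x) ⟨⟨hε.le, hlt.2.le⟩, hx⟩ (0, x) ⟨⟨le_rfl, zero_le_one⟩, hx⟩
    (by simp [Prod.dist_eq, abs_of_pos hε, hlt.1, hε₀])
  rw [Real.dist_eq] at this
  simpa [hu.initial x (mem_ellipseDomain.2 (hx.trans_lt hρ))] using this

/-- The truncated Laplace transform is close to any approximate solution of the elliptic
problem. -/
theorem exists_abs_laplaceTruncation_sub_le (hb : 0 < b) (hab : b ≤ a)
    (hu : IsLocalHeatContent (ellipseDomain a b) u) {s κ : ℝ} (hs : 0 < s) {w L : Plane → ℝ}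
    (hw : ContinuousOn w (closure (ellipseDomain a b)))
    (hw0 : ∀ x ∈ frontier (ellipseDomain a b), w x = 0)
    (hL : ∀ x ∈ ellipseDomain a b, HasCoordLaplacianAt w (L x) x)
    (hres : ∀ x ∈ ellipseDomain a b, |L x - s ^ 2 * w x + 1| ≤ κ) {δ : ℝ} (hδ : 0 < δ) :
    ∃ ε₀ > 0, ∃ T₀, ∀ ε, 0 < ε → ε < ε₀ → ∀ T, T₀ ≤ T → ε ≤ T → ∀ x ∈ ellipseDomain a b,
      |laplaceTruncation u s ε T x - w x| ≤ κ / s ^ 2 + δ := by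
  have ha : 0 < a := hb.trans_le hab
  obtain ⟨M, hM0, hM⟩ := hu.exists_bound
  -- Chosen so that the barrier's upper bound `(κ + 3η) / s² + (1 + M) η` is exactly `κ / s² + δ`.
  set η : ℝ := δ / (3 / s ^ 2 + (1 + M)) with hη
  have hηpos : 0 < η := by positivity
  have hηeq : (κ + 3 * η) / s ^ 2 + (1 + M) * η = κ / s ^ 2 + δ := by
    have h1 : η * (3 / s ^ 2 + (1 + M)) = δ := div_mul_cancel₀ _ (by positivity)
    rw [← h1]; ring
  -- The factor `(k + 2)(k + 1)` from two differentiations beats the small amplitude `η` of the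
  -- barrier.
  obtain ⟨k, hk⟩ : ∃ k : ℕ, 2 / (η * (4 / a ^ 2)) ≤ (k : ℝ) := exists_nat_ge _
  have hk' : 2 ≤ η * ((k + 2) * (k + 1)) * (4 / a ^ 2) := by
    rw [div_le_iff₀ (by positivity)] at hk
    refine hk.trans ?_
    have hk0 : (0 : ℝ) ≤ k := k.cast_nonneg
    have : (k : ℝ) ≤ (k + 2) * (k + 1) := by nlinarith
    calc (k : ℝ) * (η * (4 / a ^ 2)) ≤ ((k + 2) * (k + 1)) * (η * (4 / a ^ 2)) := by gcongr
      _ = _ := by ring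
  -- In the layer where the form exceeds `ρ`, `2 q ^ (k + 1) > 1`, so `-Δ Z` there exceeds `1`;
  -- elsewhere `u ε` is uniformly close to `1`.
  obtain ⟨ρ, hρ0, hρ1, hρ⟩ : ∃ ρ : ℝ, 0 < ρ ∧ ρ < 1 ∧ 1 / 2 < ρ ^ (k + 1) := by
    have ht : Tendsto (fun ρ : ℝ => ρ ^ (k + 1)) (𝓝[<] 1) (𝓝 1) := by
      have : Continuous fun ρ : ℝ => ρ ^ (k + 1) := by fun_prop
      simpa using (this.tendsto 1).mono_left nhdsWithin_le_nhds
    obtain ⟨ρ, h1, h2⟩ := ((ht.eventually (lt_mem_nhds (show (1 / 2 : ℝ) < 1 by norm_num))).and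
      (Ioo_mem_nhdsLT (show (0 : ℝ) < 1 by norm_num))).exists
    exact ⟨ρ, h2.1, h2.2, h1⟩
  obtain ⟨ε₁, hε₁, hinit⟩ := hu.exists_uniform_initial ha hb hρ1 hηpos
  have hT : ∃ T₀, ∀ T, T₀ ≤ T → M * Real.exp (-(s ^ 2 * T)) ≤ η := by
    have h1 : Tendsto (fun T : ℝ => M * Real.exp (-(s ^ 2 * T))) atTop (𝓝 (M * 0)) :=
      (Real.tendsto_exp_atBot.comp (tendsto_neg_atTop_atBot.comp
        (tendsto_id.const_mul_atTop (by positivity : 0 < s ^ 2)))).const_mul M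
    rw [mul_zero] at h1
    exact eventually_atTop.1 (h1.eventually (ge_mem_nhds hηpos))
  obtain ⟨T₀, hT₀⟩ := hT
  refine ⟨min ε₁ (η / (s ^ 2 * (M + 1))), by positivity, T₀, fun ε hε hεlt T hT hεT => ?_⟩
  obtain ⟨hε1, hε2⟩ := lt_min_iff.1 hεlt
  rw [lt_div_iff₀ (by positivity)] at hε2
  set Ω := ellipseDomain a b with hΩ
  set V := laplaceTruncation u s ε T with hV
  -- `Z` is at most `η` but very concave near the boundary: it pays for the initial layer, while the
  -- constant in `B` pays for `κ` and three errors of size `η`.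
  set Z : Plane → ℝ := fun x => η * (1 + -1 * ellipseForm a b x ^ (k + 2)) with hZ
  set B : Plane → ℝ := fun x => (κ + 3 * η) / s ^ 2 + (1 + M) * Z x with hB
  have hκ : 0 ≤ κ := (abs_nonneg _).trans (hres 0 (by simp [hΩ, ellipseDomain]))
  have hZ0 : ∀ x ∈ closure Ω, 0 ≤ Z x := fun x hx => by
    rw [hΩ, closure_ellipseDomain] at hx
    have : ellipseForm a b x ^ (k + 2) ≤ 1 := pow_le_one₀ (ellipseForm_nonneg a b x) hx
    exact mul_nonneg hηpos.le (by linarith)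
  have hB0 : ∀ x ∈ closure Ω, 0 ≤ B x := fun x hx => by
    have := hZ0 x hx
    positivity
  have hBle : ∀ x, B x ≤ κ / s ^ 2 + δ := fun x => by
    rw [← hηeq]
    have : 0 ≤ ellipseForm a b x ^ (k + 2) := pow_nonneg (ellipseForm_nonneg a b x) _
    have hZη : Z x ≤ η := by
      simp only [hZ]
      nlinarith
    simp only [hB]
    gcongr
  set LZ : Plane → ℝ := fun x => η * (0 + -1 * ((k + 2) * (k + 1) * ellipseForm a b x ^ k *
    (4 * x 0 ^ 2 / a ^ 4 + 4 * x 1 ^ 2 / b ^ 4)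
        + (k + 2) * ellipseForm a b x ^ (k + 1) * (2 / a ^ 2 + 2 / b ^ 2))) with hLZ
  have hLZZ : ∀ x, HasCoordLaplacianAt Z (LZ x) x := fun x =>
    ((HasCoordLaplacianAt.const 1).add
      ((hasCoordLaplacianAt_ellipseForm_pow k x).const_mul (-1))).const_mul η
  have hLZ1 : ∀ x, LZ x ≤ -(2 * ellipseForm a b x ^ (k + 1)) := by
    intro x
    have hq := ellipseForm_nonneg a b x
    -- The right side is `|∇q|²`; the lower bound uses that `a` is the major semiaxis.
    have h1 : 4 / a ^ 2 * ellipseForm a b x ≤ 4 * x 0 ^ 2 / a ^ 4 + 4 * x 1 ^ 2 / b ^ 4 := by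
      have e1 : 4 / a ^ 2 * ellipseForm a b x =
          4 * x 0 ^ 2 / a ^ 4 + 4 * x 1 ^ 2 / (a ^ 2 * b ^ 2) := by
        unfold ellipseForm
        field_simp
      rw [e1]
      gcongr
      calc b ^ 4 = b ^ 2 * b ^ 2 := by ring
        _ ≤ a ^ 2 * b ^ 2 := by gcongr
    have h2 : 0 ≤ (k + 2) * ellipseForm a b x ^ (k + 1) * (2 / a ^ 2 + 2 / b ^ 2) := by positivity
    have h3 : (k + 2) * (k + 1) * ellipseForm a b x ^ k * (4 / a ^ 2 * ellipseForm a b x) ≤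
        (k + 2) * (k + 1) * ellipseForm a b x ^ k *
          (4 * x 0 ^ 2 / a ^ 4 + 4 * x 1 ^ 2 / b ^ 4) := by gcongr
    have h4 : 2 * ellipseForm a b x ^ (k + 1) ≤
        η * ((k + 2) * (k + 1)) * (4 / a ^ 2) * ellipseForm a b x ^ (k + 1) := by gcongr
    have h5 : η * ((k + 2) * (k + 1)) * (4 / a ^ 2) * ellipseForm a b x ^ (k + 1) =
        η * ((k + 2) * (k + 1) * ellipseForm a b x ^ k * (4 / a ^ 2 * ellipseForm a b x)) := by
      ring
    have h6 : η * ((k + 2) * (k + 1) * ellipseForm a b x ^ k * (4 / a ^ 2 * ellipseForm a b x)) ≤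
        η * ((k + 2) * (k + 1) * ellipseForm a b x ^ k *
          (4 * x 0 ^ 2 / a ^ 4 + 4 * x 1 ^ 2 / b ^ 4)
          + (k + 2) * ellipseForm a b x ^ (k + 1) * (2 / a ^ 2 + 2 / b ^ 2)) := by
      gcongr
      linarith
    simp only [hLZ]
    linarith
  have hLB : ∀ x, HasCoordLaplacianAt B (0 + (1 + M) * LZ x) x := fun x =>
    (HasCoordLaplacianAt.const _).add ((hLZZ x).const_mul _)
  have hLV : ∀ x ∈ Ω, HasCoordLaplacianAt V (Real.exp (-(s ^ 2 * T)) * u T x -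
      Real.exp (-(s ^ 2 * ε)) * u ε x + s ^ 2 * V x) x := fun x hx =>
    hu.hasCoordLaplacianAt_integral (isOpen_ellipseDomain a b) s hε hεT hx
  have herr : ∀ x ∈ Ω, |Real.exp (-(s ^ 2 * T)) * u T x - Real.exp (-(s ^ 2 * ε)) * u ε x + 1|
      ≤ 3 * η + (1 + M) * (2 * ellipseForm a b x ^ (k + 1)) := by
    intro x hx
    have hq := ellipseForm_nonneg a b x
    have h1 : |Real.exp (-(s ^ 2 * T)) * u T x| ≤ η := by
      rw [abs_mul, abs_of_pos (Real.exp_pos _), mul_comm]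
      refine le_trans ?_ (hT₀ T hT)
      gcongr
      exact hM T (hε.le.trans hεT) x hx
    have hue : |u ε x| ≤ M := hM ε hε.le x hx
    have h2 : |(1 - Real.exp (-(s ^ 2 * ε))) * u ε x| ≤ η := by
      have e1 : Real.exp (-(s ^ 2 * ε)) ≤ 1 := Real.exp_le_one_iff.2 (by
        have : 0 ≤ s ^ 2 * ε := by positivity
        linarith)
      have e2 := Real.add_one_le_exp (-(s ^ 2 * ε))
      rw [abs_mul, abs_of_nonneg (by linarith)]
      calc (1 - Real.exp (-(s ^ 2 * ε))) * |u ε x| ≤ (s ^ 2 * ε) * M :=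
            mul_le_mul (by linarith) hue (abs_nonneg _) (by positivity)
        _ ≤ ε * (s ^ 2 * (M + 1)) := by
            have : 0 ≤ ε * s ^ 2 := by positivity
            linarith
        _ ≤ η := hε2.le
    -- Inside the compact sublevel set, uniform convergence to the initial value; in the boundary
    -- layer, the trivial bound `1 + M`, which the barrier absorbs.
    have h3 : |1 - u ε x| ≤ η + (1 + M) * (2 * ellipseForm a b x ^ (k + 1)) := by
      by_cases hxρ : ellipseForm a b x ≤ ρ
      · rw [abs_sub_comm]
        have := (hinit ε hε hε1 x hxρ).le
        have : 0 ≤ (1 + M) * (2 * ellipseForm a b x ^ (k + 1)) := by positivity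
        linarith
      · push Not at hxρ
        have e1 : ρ ^ (k + 1) ≤ ellipseForm a b x ^ (k + 1) := by gcongr
        have e2 : |1 - u ε x| ≤ 1 + M := by
          refine (abs_sub _ _).trans ?_
          rw [abs_one]
          linarith
        have e3 : (1 + M) * 1 ≤ (1 + M) * (2 * ellipseForm a b x ^ (k + 1)) := by
          gcongr
          linarith
        linarith
    have h4 : Real.exp (-(s ^ 2 * T)) * u T x - Real.exp (-(s ^ 2 * ε)) * u ε x + 1 =
        Real.exp (-(s ^ 2 * T)) * u T x + (1 - Real.exp (-(s ^ 2 * ε))) * u ε x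
          + (1 - u ε x) := by ring
    rw [h4]
    refine (abs_add_three _ _ _).trans ?_
    linarith
  have hVc : ContinuousOn V (closure Ω) := hu.continuousOn_laplaceTruncation ha hb s hε hεT
  have hBc : ContinuousOn B (closure Ω) := by
    have := continuous_ellipseForm a b
    exact Continuous.continuousOn (by fun_prop)
  have hbdy : ∀ x ∈ closure Ω \ Ω, V x = 0 ∧ w x = 0 := fun x hx => by
    have hx' : x ∈ frontier Ω := by
      rw [frontier, (isOpen_ellipseDomain a b).interior_eq]; exact hx
    exact ⟨hu.laplaceTruncation_eq_zero s hε hεT hx', hw0 x hx'⟩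
  -- The sign `σ` gives both the upper and the lower comparison from one application of the maximum
  -- principle.
  have hcmp : ∀ σ : ℝ, |σ| = 1 → ∀ x ∈ Ω, σ * (V x + -1 * w x) + -1 * B x ≤ 0 := by
    intro σ hσ x hx
    refine nonpos_of_subsolution (f := fun x => σ * (V x + -1 * w x) + -1 * B x)
      (isOpen_ellipseDomain a b) (isCompact_closure_ellipseDomain ha hb)
      subset_closure (((hVc.add (hw.const_mul (-1))).const_mul σ).add (hBc.const_mul (-1))) ?_ hs
      (fun y hy => (((hLV y hy).add ((hL y hy).const_mul (-1))).const_mul σ).add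
        ((hLB y).const_mul (-1))) ?_ x (subset_closure hx)
    · intro y hy
      have := hB0 y hy.1
      simp only [(hbdy y hy).1, (hbdy y hy).2]
      linarith
    · intro y hy
      set E := Real.exp (-(s ^ 2 * T)) * u T y - Real.exp (-(s ^ 2 * ε)) * u ε y + 1 with hE
      have h1 : σ * (E - (L y - s ^ 2 * w y + 1)) ≥
          -(3 * η + (1 + M) * (2 * ellipseForm a b y ^ (k + 1)) + κ) := by
        have h2 : |σ * (E - (L y - s ^ 2 * w y + 1))| ≤
            3 * η + (1 + M) * (2 * ellipseForm a b y ^ (k + 1)) + κ := by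
          rw [abs_mul, hσ, one_mul]
          exact (abs_sub _ _).trans (add_le_add (herr y hy) (hres y hy))
        exact (abs_le.1 h2).1
      have h3 : (1 + M) * LZ y ≤ (1 + M) * -(2 * ellipseForm a b y ^ (k + 1)) := by
        gcongr
        exact hLZ1 y
      have h4 : s ^ 2 * B y ≥ κ + 3 * η := by
        have e1 : s ^ 2 * B y = κ + 3 * η + s ^ 2 * ((1 + M) * Z y) := by
          simp only [hB]
          field_simp
        have := hZ0 y (subset_closure hy)
        rw [e1]
        have : 0 ≤ s ^ 2 * ((1 + M) * Z y) := by positivity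
        linarith
      have h5 : σ * (Real.exp (-(s ^ 2 * T)) * u T y - Real.exp (-(s ^ 2 * ε)) * u ε y +
          s ^ 2 * V y + -1 * L y) =
          σ * (E - (L y - s ^ 2 * w y + 1)) + s ^ 2 * (σ * (V y + -1 * w y)) := by
        simp only [hE]; ring
      rw [h5]
      linarith
  intro x hx
  rw [abs_le]
  have h1 := hcmp 1 (by simp) x hx
  have h2 := hcmp (-1) (by simp) x hx
  have h3 := hBle x
  constructor <;> linarith

/-! ### Removing the time truncation: Fubini and passage to the limit -/

theorem aestronglyMeasurable_uncurry (hu : IsLocalHeatContent (ellipseDomain a b) u) :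
    AEStronglyMeasurable (fun p : ℝ × Plane => u p.1 p.2)
      ((volume.restrict (Ioi 0)).prod (volume.restrict (ellipseDomain a b))) := by
  rw [Measure.prod_restrict]
  exact hu.contDiffOn.continuousOn.aestronglyMeasurable
    (measurableSet_Ioi.prod (isOpen_ellipseDomain a b).measurableSet)

theorem integrableOn_exp_mul_heatContent (ha : 0 < a) (hb : 0 < b)
    (hu : IsLocalHeatContent (ellipseDomain a b) u) {s : ℝ} (hs : 0 < s) :
    IntegrableOn (fun t => Real.exp (-(s ^ 2 * t)) * heatContent (ellipseDomain a b) u t)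
      (Ioi 0) := by
  obtain ⟨M, hM0, hM⟩ := hu.exists_bound
  have hexp : IntegrableOn (fun t : ℝ => Real.exp (-(s ^ 2 * t))) (Ioi 0) := by
    simpa using exp_neg_integrableOn_Ioi 0 (show 0 < s ^ 2 by positivity)
  refine (hexp.mul_const M).mono' ?_ ?_
  · have h1 := hu.aestronglyMeasurable_uncurry.integral_prod_right'
    have h2 : AEStronglyMeasurable (fun t => heatContent (ellipseDomain a b) u t)
        (volume.restrict (Ioi 0)) := by
      simp only [heatContent, setAverage_eq]
      exact h1.const_smul (volume.real (ellipseDomain a b))⁻¹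
    exact (by fun_prop : Continuous fun t : ℝ =>
      Real.exp (-(s ^ 2 * t))).aestronglyMeasurable.mul h2
  · refine (ae_restrict_mem measurableSet_Ioi).mono fun t ht => ?_
    rw [norm_mul, Real.norm_eq_abs, abs_of_pos (Real.exp_pos _)]
    gcongr
    exact abs_setAverage_le (volume_ellipseDomain_ne_top ha hb)
      (volume_real_ellipseDomain_pos ha hb)
      fun x hx => hM t (mem_Ioi.1 ht).le x hx

theorem average_laplaceTruncation (ha : 0 < a) (hb : 0 < b)
    (hu : IsLocalHeatContent (ellipseDomain a b) u) (s : ℝ) {ε T : ℝ} (hε : 0 < ε) (hT : ε ≤ T) :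
    ⨍ x in ellipseDomain a b, laplaceTruncation u s ε T x =
      ∫ t in Ioc ε T, Real.exp (-(s ^ 2 * t)) * heatContent (ellipseDomain a b) u t := by
  obtain ⟨M, hM0, hM⟩ := hu.exists_bound
  have hm : MeasurableSet (ellipseDomain a b) := (isOpen_ellipseDomain a b).measurableSet
  have hfin := volume_ellipseDomain_ne_top ha hb
  have hint : Integrable (Function.uncurry fun t x => Real.exp (-(s ^ 2 * t)) * u t x)
      ((volume.restrict (Ioc ε T)).prod (volume.restrict (ellipseDomain a b))) := by
    have : IsFiniteMeasure (volume.restrict (ellipseDomain a b)) :=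
      isFiniteMeasure_restrict.2 hfin
    refine Integrable.of_bound (C := M) ?_ ?_
    · rw [Measure.prod_restrict]
      refine ContinuousOn.aestronglyMeasurable (ContinuousOn.mul (by fun_prop)
        (hu.contDiffOn.continuousOn.mono ?_)) (measurableSet_Ioc.prod hm)
      exact prod_mono (fun t ht => hε.trans ht.1) Subset.rfl
    · rw [Measure.prod_restrict]
      refine (ae_restrict_mem (measurableSet_Ioc.prod hm)).mono fun p hp => ?_
      have hp1 : 0 < p.1 := hε.trans hp.1.1
      simp only [Function.uncurry, norm_mul, Real.norm_eq_abs, abs_of_pos (Real.exp_pos _)]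
      calc Real.exp (-(s ^ 2 * p.1)) * |u p.1 p.2| ≤ 1 * M := by
            gcongr
            · exact Real.exp_le_one_iff.2 (by nlinarith [sq_nonneg s])
            · exact hM p.1 hp1.le p.2 hp.2
        _ = M := one_mul M
  have hswap := integral_integral_swap hint
  simp only [setAverage_eq, heatContent, smul_eq_mul, laplaceTruncation,
    intervalIntegral.integral_of_le hT]
  rw [← hswap, ← integral_const_mul]
  refine integral_congr_ae (.of_forall fun t => ?_)
  simp only
  rw [integral_const_mul]
  ring

/-- The Laplace transform of the heat content is close to the average of any approximate solution
of the elliptic problem. -/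
theorem abs_laplaceHeatContent_sub_average_le (hb : 0 < b) (hab : b ≤ a)
    (hu : IsLocalHeatContent (ellipseDomain a b) u) {s κ : ℝ} (hs : 0 < s) {w L : Plane → ℝ}
    (hw : ContinuousOn w (closure (ellipseDomain a b)))
    (hw0 : ∀ x ∈ frontier (ellipseDomain a b), w x = 0)
    (hL : ∀ x ∈ ellipseDomain a b, HasCoordLaplacianAt w (L x) x)
    (hres : ∀ x ∈ ellipseDomain a b, |L x - s ^ 2 * w x + 1| ≤ κ) :
    |laplaceHeatContent (ellipseDomain a b) u s - ⨍ x in ellipseDomain a b, w x| ≤ κ / s ^ 2 := by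
  have ha : 0 < a := hb.trans_le hab
  have hfin := volume_ellipseDomain_ne_top ha hb
  have hcover : AECover (volume.restrict (Ioi (0 : ℝ))) atTop
      fun n : ℕ => Ioc (1 / ((n : ℝ) + 1)) ((n : ℝ) + 1) := by
    have h1 : AECover (volume.restrict (Ioi (0 : ℝ))) atTop
        fun n : ℕ => Ioi (1 / ((n : ℝ) + 1)) :=
      aecover_Ioi_of_Ioi tendsto_one_div_add_atTop_nhds_zero_nat
    have h2 : AECover (volume.restrict (Ioi (0 : ℝ))) atTop fun n : ℕ => Iic ((n : ℝ) + 1) :=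
      aecover_Iic (tendsto_atTop_add_const_right _ _ tendsto_natCast_atTop_atTop)
    exact h1.inter h2
  have hlim := hcover.integral_tendsto_of_countably_generated
    (hu.integrableOn_exp_mul_heatContent ha hb hs)
  have hlim' : Tendsto (fun n : ℕ => |(∫ t in Ioc (1 / ((n : ℝ) + 1)) ((n : ℝ) + 1),
      Real.exp (-(s ^ 2 * t)) * heatContent (ellipseDomain a b) u t)
        - ⨍ x in ellipseDomain a b, w x|) atTop
      (𝓝 |laplaceHeatContent (ellipseDomain a b) u s - ⨍ x in ellipseDomain a b, w x|) := by
    refine (Tendsto.sub_const ?_ _).abs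
    refine hlim.congr fun n => ?_
    rw [Measure.restrict_restrict measurableSet_Ioc, inter_eq_left.2]
    exact fun t ht => lt_trans (by positivity) ht.1
  refine le_of_forall_pos_le_add fun δ hδ => ?_
  obtain ⟨ε₀, hε₀, T₀, h⟩ := hu.exists_abs_laplaceTruncation_sub_le hb hab hs hw hw0 hL hres hδ
  refine le_of_tendsto hlim' ?_
  filter_upwards [(tendsto_one_div_add_atTop_nhds_zero_nat (𝕜 := ℝ)).eventually
    (gt_mem_nhds hε₀), (tendsto_atTop_add_const_right atTop (1 : ℝ)
      (tendsto_natCast_atTop_atTop (R := ℝ))).eventually_ge_atTop T₀] with n hn1 hn2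
  have hε : 0 < 1 / ((n : ℝ) + 1) := by positivity
  have hεT : 1 / ((n : ℝ) + 1) ≤ n + 1 := by
    rw [div_le_iff₀ (by positivity)]
    nlinarith [(n.cast_nonneg : (0 : ℝ) ≤ n)]
  have hVc := hu.continuousOn_laplaceTruncation ha hb s hε hεT
  have hV : IntegrableOn (laplaceTruncation u s (1 / ((n : ℝ) + 1)) (n + 1))
      (ellipseDomain a b) :=
    (hVc.integrableOn_compact (isCompact_closure_ellipseDomain ha hb)).mono_set subset_closure
  have hwi : IntegrableOn w (ellipseDomain a b) :=
    (hw.integrableOn_compact (isCompact_closure_ellipseDomain ha hb)).mono_set subset_closure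
  rw [← hu.average_laplaceTruncation ha hb s hε hεT]
  have hsub : (⨍ x in ellipseDomain a b, laplaceTruncation u s (1 / ((n : ℝ) + 1)) (n + 1) x) -
      ⨍ x in ellipseDomain a b, w x = ⨍ x in ellipseDomain a b,
        (laplaceTruncation u s (1 / ((n : ℝ) + 1)) (n + 1) x - w x) := by
    simp only [setAverage_eq, smul_eq_mul]
    rw [integral_sub hV hwi, mul_sub]
  rw [hsub]
  exact abs_setAverage_le hfin (volume_real_ellipseDomain_pos ha hb)
    (h _ hε hn1 _ hn2 hεT)

end IsLocalHeatContent

/-! ### Smooth profiles across the tips of the ellipse -/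

/-- The entire function `∑ z ^ k / (2 k)!` on the real line, which is `cosh √z` for `z ≥ 0`. -/
noncomputable def coshSqrt (z : ℝ) : ℝ := (∑' k : ℕ, (z : ℂ) ^ k / ((2 * k).factorial : ℂ)).re

/-- On a disk the terms are dominated by those of an exponential series, as `k! ≤ (2k)!`; holomorphy
then gives smoothness of `coshSqrt` of every order. -/
theorem differentiable_tsum_pow_div_factorial :
    Differentiable ℂ fun z : ℂ => ∑' k : ℕ, z ^ k / ((2 * k).factorial : ℂ) := by
  intro z
  have hR : DifferentiableOn ℂ (fun z : ℂ => ∑' k : ℕ, z ^ k / ((2 * k).factorial : ℂ))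
      (Metric.ball 0 (‖z‖ + 1)) := by
    refine Complex.differentiableOn_tsum_of_summable_norm
      (u := fun k => (‖z‖ + 1) ^ k / (k.factorial : ℝ)) (Real.summable_pow_div_factorial _)
      (fun k => by fun_prop) Metric.isOpen_ball fun k w hw => ?_
    have hw' : ‖w‖ < ‖z‖ + 1 := by simpa using hw
    rw [norm_div, norm_pow, Complex.norm_natCast]
    gcongr
    omega
  exact hR.differentiableAt (Metric.isOpen_ball.mem_nhds (by simp))

theorem contDiff_coshSqrt {n : WithTop ℕ∞} : ContDiff ℝ n coshSqrt :=
  ContDiff.real_of_complex differentiable_tsum_pow_div_factorial.contDiff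

theorem coshSqrt_sq (x : ℝ) : coshSqrt (x ^ 2) = Real.cosh x := by
  have h := Complex.cosh_eq_tsum (x : ℂ)
  rw [← Complex.cosh_ofReal_re, h, coshSqrt]
  push_cast
  simp only [pow_mul]

/-- Differentiate `coshSqrt (x²) = cosh x`. This exhibits `h tanh (s h)` as a smooth function of
`h²`. -/
theorem sinh_eq_deriv_coshSqrt (x : ℝ) : Real.sinh x = 2 * x * deriv coshSqrt (x ^ 2) := by
  have h1 : HasDerivAt (fun x : ℝ => coshSqrt (x ^ 2)) (deriv coshSqrt (x ^ 2) * (2 * x)) x := by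
    have h := ((contDiff_coshSqrt (n := 1)).differentiable one_ne_zero
      (x ^ 2)).hasDerivAt.comp x (hasDerivAt_pow 2 x)
    simpa [Function.comp_def] using h
  simp only [coshSqrt_sq] at h1
  rw [(Real.hasDerivAt_cosh x).unique h1]
  ring

/-- The function `sech (s √(b ^ 2 - ξ ^ 2))`, extended analytically through `|ξ| = b`. -/
noncomputable def sechProfile (b s ξ : ℝ) : ℝ := (coshSqrt (s ^ 2 * (b ^ 2 - ξ ^ 2)))⁻¹

/-- The function `h tanh (s h)` of `h = √(b ^ 2 - ξ ^ 2)`, extended through `|ξ| = b`. -/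
noncomputable def tanhProfile (b s ξ : ℝ) : ℝ :=
  2 * s * (b ^ 2 - ξ ^ 2) * deriv coshSqrt (s ^ 2 * (b ^ 2 - ξ ^ 2)) * sechProfile b s ξ

theorem sechProfile_of_sq_add_sq {b s ξ y : ℝ} (h : ξ ^ 2 + y ^ 2 = b ^ 2) :
    sechProfile b s ξ = (Real.cosh (s * y))⁻¹ := by
  rw [sechProfile, ← coshSqrt_sq, ← h]
  ring_nf

theorem tanhProfile_of_sq_add_sq {b s ξ y : ℝ} (h : ξ ^ 2 + y ^ 2 = b ^ 2) :
    tanhProfile b s ξ = y * Real.sinh (s * y) * (Real.cosh (s * y))⁻¹ := by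
  rw [tanhProfile, sechProfile_of_sq_add_sq h, sinh_eq_deriv_coshSqrt, ← h,
    show s ^ 2 * (ξ ^ 2 + y ^ 2 - ξ ^ 2) = (s * y) ^ 2 by ring]
  ring

/-- The open set on which the profiles are smooth. -/
def profileDomain (b s : ℝ) : Set ℝ := {ξ | coshSqrt (s ^ 2 * (b ^ 2 - ξ ^ 2)) ≠ 0}

theorem isOpen_profileDomain (b s : ℝ) : IsOpen (profileDomain b s) := by
  have : Continuous fun ξ : ℝ => coshSqrt (s ^ 2 * (b ^ 2 - ξ ^ 2)) :=
    (contDiff_coshSqrt (n := 0)).continuous.comp (by fun_prop)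
  exact isOpen_ne_fun this continuous_const

theorem sq_add_sqrt_sq {b ξ : ℝ} (hξ : ξ ∈ Icc (-b) b) : ξ ^ 2 + √(b ^ 2 - ξ ^ 2) ^ 2 = b ^ 2 := by
  rw [Real.sq_sqrt (by nlinarith [hξ.1, hξ.2])]
  ring

/-- For `|ξ| ≤ b` the argument of `coshSqrt` is a real square, so its value is a hyperbolic cosine.
Smoothness is therefore available on an open set containing the closed interval, tips included. -/
theorem Icc_subset_profileDomain (b s : ℝ) : Icc (-b) b ⊆ profileDomain b s := by
  intro ξ hξ
  have h := sechProfile_of_sq_add_sq (s := s) (sq_add_sqrt_sq hξ)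
  intro h0
  rw [sechProfile, h0, inv_zero, eq_comm, inv_eq_zero] at h
  exact (Real.cosh_pos _).ne' h

open scoped ContDiff in
theorem contDiffOn_sechProfile (b s : ℝ) : ContDiffOn ℝ ∞ (sechProfile b s) (profileDomain b s) :=
  ContDiffOn.inv (contDiff_coshSqrt.comp (by fun_prop)).contDiffOn fun _ hξ => hξ

open scoped ContDiff in
theorem contDiffOn_tanhProfile (b s : ℝ) :
    ContDiffOn ℝ ∞ (tanhProfile b s) (profileDomain b s) := by
  have h1 : ContDiff ℝ ∞ (deriv coshSqrt) := by
    have h : ContDiff ℝ (∞ + 1) coshSqrt := contDiff_coshSqrt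
    exact (contDiff_succ_iff_deriv.1 h).2.2
  exact ContDiffOn.mul (ContDiff.contDiffOn
    (ContDiff.mul (by fun_prop) (h1.comp (by fun_prop)))) (contDiffOn_sechProfile b s)

open scoped ContDiff in
theorem contDiffOn_deriv_deriv {φ : ℝ → ℝ} {U : Set ℝ} (hU : IsOpen U) (hφ : ContDiffOn ℝ ∞ φ U) :
    ContDiffOn ℝ ∞ (deriv (deriv φ)) U :=
  (hφ.deriv_of_isOpen hU (m := ∞) (by simp)).deriv_of_isOpen hU (by simp)

open scoped ContDiff in
theorem hasSecondDerivAt_of_contDiffOn {φ : ℝ → ℝ} {U : Set ℝ} (hU : IsOpen U)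
    (hφ : ContDiffOn ℝ ∞ φ U) {ξ : ℝ} (hξ : ξ ∈ U) :
    HasSecondDerivAt φ (deriv (deriv φ) ξ) ξ := by
  refine ⟨deriv φ, ?_, ?_⟩
  · filter_upwards [hU.mem_nhds hξ] with ρ hρ
    exact ((hφ.differentiableOn (by simp)).differentiableAt (hU.mem_nhds hρ)).hasDerivAt
  · exact (((hφ.deriv_of_isOpen hU (m := ∞) (by simp)).differentiableOn
      (by simp)).differentiableAt (hU.mem_nhds hξ)).hasDerivAt

theorem hasSecondDerivAt_cosh (s r : ℝ) :
    HasSecondDerivAt (fun ρ => Real.cosh (s * ρ)) (s ^ 2 * Real.cosh (s * r)) r := by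
  have h1 : ∀ ρ : ℝ, HasDerivAt (fun ρ : ℝ => s * ρ) s ρ := fun ρ => by
    simpa using (hasDerivAt_id ρ).const_mul s
  refine ⟨fun ρ => Real.sinh (s * ρ) * s, .of_forall fun ρ => (h1 ρ).cosh, ?_⟩
  refine ((h1 r).sinh.mul_const s).congr_deriv ?_
  ring

theorem hasSecondDerivAt_mul_sinh (s r : ℝ) :
    HasSecondDerivAt (fun ρ => ρ * Real.sinh (s * ρ))
      (2 * s * Real.cosh (s * r) + s ^ 2 * (r * Real.sinh (s * r))) r := by
  have h1 : ∀ ρ : ℝ, HasDerivAt (fun ρ : ℝ => s * ρ) s ρ := fun ρ => by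
    simpa using (hasDerivAt_id ρ).const_mul s
  refine ⟨fun ρ => 1 * Real.sinh (s * ρ) + ρ * (Real.cosh (s * ρ) * s),
    .of_forall fun ρ => (hasDerivAt_id ρ).mul (h1 ρ).sinh, ?_⟩
  refine (((h1 r).sinh.const_mul 1).add
    ((hasDerivAt_id r).mul ((h1 r).cosh.mul_const s))).congr_deriv ?_
  simp
  ring

/-! ### The approximate solution of the elliptic problem -/

/-- The factor `g''` of the correction of first order. -/
noncomputable def sechProfile₂ (b s : ℝ) : ℝ → ℝ := deriv (deriv (sechProfile b s))

/-- The first two terms of the expansion of the solution in stretched coordinates. -/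
noncomputable def stretchedSolution (b s lam ξ y : ℝ) : ℝ :=
  (1 / s ^ 2 + -(1 / s ^ 2) * (Real.cosh (s * y) * sechProfile b s ξ)) +
    lam / (2 * s ^ 3) * (y * Real.sinh (s * y) * sechProfile₂ b s ξ +
      -Real.cosh (s * y) * (sechProfile₂ b s ξ * tanhProfile b s ξ))

/-- The approximate solution of `Δ v - s ^ 2 v = - 1` on the ellipse. -/
noncomputable def approxSolution (b s lam : ℝ) (x : Plane) : ℝ :=
  stretchedSolution b s lam (√lam * x 0) (x 1)

/-- The residual of the approximate solution, up to a factor `lam ^ 2`. -/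
noncomputable def stretchedResidual (b s ξ y : ℝ) : ℝ :=
  (y * Real.sinh (s * y) * deriv (deriv (sechProfile₂ b s)) ξ +
    -Real.cosh (s * y) *
      deriv (deriv fun ξ => sechProfile₂ b s ξ * tanhProfile b s ξ) ξ) / (2 * s ^ 3)

open scoped ContDiff in
theorem contDiffOn_sechProfile₂ (b s : ℝ) :
    ContDiffOn ℝ ∞ (sechProfile₂ b s) (profileDomain b s) :=
  contDiffOn_deriv_deriv (isOpen_profileDomain b s) (contDiffOn_sechProfile b s)

open scoped ContDiff in
theorem contDiffOn_sechProfile₂_mul_tanhProfile (b s : ℝ) :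
    ContDiffOn ℝ ∞ (fun ξ => sechProfile₂ b s ξ * tanhProfile b s ξ) (profileDomain b s) :=
  (contDiffOn_sechProfile₂ b s).mul (contDiffOn_tanhProfile b s)

/-- In the form `λ ∂ξ² + ∂y²`, orders `1` and `λ` cancel: `y sinh (s y) / (2 s³)` is the resonant
response to the source `cosh (s y) / s²` produced by `λ ∂ξ²` on the leading term. Only `λ ∂ξ²` of
the correction survives. -/
theorem hasCoordLaplacianAt_approxSolution {b s lam : ℝ} (hs : 0 < s) (hlam : 0 < lam)
    {x : Plane} (hx : √lam * x 0 ∈ profileDomain b s) :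
    HasCoordLaplacianAt (approxSolution b s lam)
      (s ^ 2 * approxSolution b s lam x - 1 + lam ^ 2 * stretchedResidual b s (√lam * x 0) (x 1))
      x := by
  have hU := isOpen_profileDomain b s
  have hsq : √lam ^ 2 = lam := Real.sq_sqrt hlam.le
  have hξ : ∀ {φ : ℝ → ℝ} {d : ℝ}, HasSecondDerivAt φ d (√lam * x 0) →
      HasSecondDerivAt (fun r => φ (√lam * r)) (lam * d) (x 0) := fun {φ d} h => by
    have := HasSecondDerivAt.comp_const_mul_add (r := x 0) √lam 0 (by simpa using h)
    simpa [hsq] using this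
  have hp := hξ ((((hasSecondDerivAt_of_contDiffOn hU (contDiffOn_sechProfile b s)
      hx).const_mul (Real.cosh (s * x 1))).const_mul (-(1 / s ^ 2))).add
    ((((hasSecondDerivAt_of_contDiffOn hU (contDiffOn_sechProfile₂ b s) hx).const_mul
      (x 1 * Real.sinh (s * x 1))).add
      ((hasSecondDerivAt_of_contDiffOn hU (contDiffOn_sechProfile₂_mul_tanhProfile b s)
        hx).const_mul (-Real.cosh (s * x 1)))).const_mul (lam / (2 * s ^ 3))))
  have hp' := (HasSecondDerivAt.const (1 / s ^ 2)).add hp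
  have hq := ((((hasSecondDerivAt_cosh s (x 1)).const_mul
      (sechProfile b s (√lam * x 0))).const_mul (-(1 / s ^ 2))).add
    ((((hasSecondDerivAt_mul_sinh s (x 1)).const_mul (sechProfile₂ b s (√lam * x 0))).add
      ((hasSecondDerivAt_cosh s (x 1)).const_mul
        (-(sechProfile₂ b s (√lam * x 0) * tanhProfile b s (√lam * x 0))))).const_mul
          (lam / (2 * s ^ 3))))
  have hq' := (HasSecondDerivAt.const (1 / s ^ 2)).add hq
  have h := hasCoordLaplacianAt_of_coords
    (φ := fun p q => stretchedSolution b s lam (√lam * p) q) (x := x)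
    (by
      convert hp' using 1
      funext r
      simp only [stretchedSolution]
      ring)
    (by
      convert hq' using 1
      funext r
      simp only [stretchedSolution]
      ring)
  refine (congrArg (fun L => HasCoordLaplacianAt (approxSolution b s lam) L x) ?_).mp h
  simp only [approxSolution, stretchedSolution, stretchedResidual, sechProfile₂]
  field_simp
  ring

/-- On the boundary `sechProfile` is `1 / cosh (s y)` and `tanhProfile` is `y tanh (s y)`, so each
order vanishes separately. -/
theorem approxSolution_eq_zero {b s lam : ℝ} {x : Plane}
    (h : (√lam * x 0) ^ 2 + x 1 ^ 2 = b ^ 2) : approxSolution b s lam x = 0 := by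
  have hc := (Real.cosh_pos (s * x 1)).ne'
  rw [approxSolution, stretchedSolution, sechProfile_of_sq_add_sq h, tanhProfile_of_sq_add_sq h]
  field_simp
  ring

theorem ellipseForm_stretched {b lam : ℝ} (hlam : 0 ≤ lam) (x : Plane) :
    ellipseForm (b / √lam) b x = ((√lam * x 0) ^ 2 + x 1 ^ 2) / b ^ 2 := by
  rw [ellipseForm, div_pow, mul_pow, div_div_eq_mul_div, Real.sq_sqrt hlam]
  ring

theorem mem_closure_stretched {b lam : ℝ} (hb : 0 < b) (hlam : 0 < lam) {x : Plane} :
    x ∈ closure (ellipseDomain (b / √lam) b) ↔ (√lam * x 0) ^ 2 + x 1 ^ 2 ≤ b ^ 2 := by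
  rw [closure_ellipseDomain, mem_ofPred_eq, ellipseForm_stretched hlam.le,
    div_le_one (by positivity)]

theorem mem_Icc_of_sq_add_sq_le {b ξ y : ℝ} (hb : 0 < b) (h : ξ ^ 2 + y ^ 2 ≤ b ^ 2) :
    ξ ∈ Icc (-b) b ∧ y ∈ Icc (-b) b := by
  constructor
  · exact abs_le.1 (abs_le_of_sq_le_sq (by nlinarith) hb.le)
  · exact abs_le.1 (abs_le_of_sq_le_sq (by nlinarith) hb.le)

theorem continuousOn_stretchedSolution (b s lam : ℝ) :
    ContinuousOn (fun p : ℝ × ℝ => stretchedSolution b s lam p.1 p.2)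
      (Icc (-b) b ×ˢ univ) := by
  have hfst : MapsTo (Prod.fst : ℝ × ℝ → ℝ) (Icc (-b) b ×ˢ univ) (profileDomain b s) :=
    fun p hp => Icc_subset_profileDomain b s hp.1
  have h1 := (contDiffOn_sechProfile b s).continuousOn.comp continuousOn_fst hfst
  have h2 := (contDiffOn_sechProfile₂ b s).continuousOn.comp continuousOn_fst hfst
  have h3 := (contDiffOn_tanhProfile b s).continuousOn.comp continuousOn_fst hfst
  simp only [Function.comp_def] at h1 h2 h3
  unfold stretchedSolution
  fun_prop

theorem exists_bound_stretchedResidual (b s : ℝ) :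
    ∃ C, ∀ ξ ∈ Icc (-b) b, ∀ y ∈ Icc (-b) b, |stretchedResidual b s ξ y| ≤ C := by
  have hU := isOpen_profileDomain b s
  have hfst : MapsTo (Prod.fst : ℝ × ℝ → ℝ) (Icc (-b) b ×ˢ Icc (-b) b) (profileDomain b s) :=
    fun p hp => Icc_subset_profileDomain b s hp.1
  have h1 := (contDiffOn_deriv_deriv hU (contDiffOn_sechProfile₂ b s)).continuousOn.comp
    continuousOn_fst hfst
  have h2 := (contDiffOn_deriv_deriv hU
    (contDiffOn_sechProfile₂_mul_tanhProfile b s)).continuousOn.comp continuousOn_fst hfst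
  simp only [Function.comp_def] at h1 h2
  have hc : ContinuousOn (fun p : ℝ × ℝ => stretchedResidual b s p.1 p.2)
      (Icc (-b) b ×ˢ Icc (-b) b) := by
    unfold stretchedResidual
    fun_prop
  obtain ⟨C, hC⟩ := (isCompact_Icc.prod isCompact_Icc).exists_bound_of_continuousOn hc
  exact ⟨C, fun ξ hξ y hy => hC (ξ, y) ⟨hξ, hy⟩⟩

theorem exists_abs_laplaceHeatContent_sub_average_approxSolution_le {b s : ℝ} (hb : 0 < b)
    (hs : 0 < s) :
    ∃ C, ∀ lam ∈ Ioo (0 : ℝ) 1, ∀ u, IsLocalHeatContent (ellipseDomain (b / √lam) b) u →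
      |laplaceHeatContent (ellipseDomain (b / √lam) b) u s -
        ⨍ x in ellipseDomain (b / √lam) b, approxSolution b s lam x| ≤ C * lam ^ 2 := by
  obtain ⟨C, hC⟩ := exists_bound_stretchedResidual b s
  refine ⟨C / s ^ 2, fun lam hlam u hu => ?_⟩
  have hl : 0 < √lam := Real.sqrt_pos.2 hlam.1
  have hab : b ≤ b / √lam := by
    rw [le_div_iff₀ hl]
    have : √lam ≤ 1 := Real.sqrt_le_one.2 hlam.2.le
    nlinarith
  have hmem : ∀ x ∈ closure (ellipseDomain (b / √lam) b),
      √lam * x 0 ∈ Icc (-b) b ∧ x 1 ∈ Icc (-b) b := fun x hx =>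
    mem_Icc_of_sq_add_sq_le hb ((mem_closure_stretched hb hlam.1).1 hx)
  have h := hu.abs_laplaceHeatContent_sub_average_le hb hab hs (w := approxSolution b s lam)
    (κ := C * lam ^ 2) ?_ ?_
    (fun x hx => hasCoordLaplacianAt_approxSolution hs hlam.1
      (Icc_subset_profileDomain b s (hmem x (subset_closure hx)).1)) ?_
  · rwa [div_mul_eq_mul_div]
  · exact (continuousOn_stretchedSolution b s lam).comp
      (f := fun x : Plane => (√lam * x 0, x 1)) (by fun_prop) fun x hx => ⟨(hmem x hx).1, trivial⟩
  · intro x hx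
    rw [frontier_ellipseDomain, mem_ofPred_eq, ellipseForm_stretched hlam.1.le,
      div_eq_one_iff_eq (by positivity)] at hx
    exact approxSolution_eq_zero hx
  · intro x hx
    have hx' := hmem x (subset_closure hx)
    rw [show s ^ 2 * approxSolution b s lam x - 1 + lam ^ 2 *
      stretchedResidual b s (√lam * x 0) (x 1) - s ^ 2 * approxSolution b s lam x + 1 =
      lam ^ 2 * stretchedResidual b s (√lam * x 0) (x 1) by ring, abs_mul,
      abs_of_nonneg (sq_nonneg lam), mul_comm]
    gcongr
    exact hC _ hx'.1 _ hx'.2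

/-! ### Averages over the ellipse -/

/-- The half-length `√(b ^ 2 - ξ ^ 2)` of the vertical chord of the disk of radius `b`. -/
noncomputable def halfChord (b ξ : ℝ) : ℝ := √(b ^ 2 - ξ ^ 2)

theorem continuous_halfChord (b : ℝ) : Continuous (halfChord b) := by
  unfold halfChord
  fun_prop

theorem halfChord_nonneg (b ξ : ℝ) : 0 ≤ halfChord b ξ := Real.sqrt_nonneg _

theorem halfChord_sq {b ξ : ℝ} (hξ : ξ ∈ Icc (-b) b) : halfChord b ξ ^ 2 = b ^ 2 - ξ ^ 2 :=
  Real.sq_sqrt (by nlinarith [hξ.1, hξ.2])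

theorem halfChord_pos {b ξ : ℝ} (hξ : ξ ∈ Ioo (-b) b) : 0 < halfChord b ξ :=
  Real.sqrt_pos.2 (by nlinarith [hξ.1, hξ.2])

theorem setIntegral_stretched {b lam : ℝ} (hb : 0 < b) (hlam : 0 < lam) {F : ℝ → ℝ → ℝ}
    (hF : IntegrableOn (fun x : Plane => F (√lam * x 0) (x 1)) (ellipseDomain (b / √lam) b)) :
    ∫ x in ellipseDomain (b / √lam) b, F (√lam * x 0) (x 1) =
      (√lam)⁻¹ * ∫ ξ in (-b)..b, ∫ y in (-halfChord b ξ)..halfChord b ξ, F ξ y := by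
  have hl : 0 < √lam := Real.sqrt_pos.2 hlam
  set e : Plane ≃ᵐ ℝ × ℝ :=
    (MeasurableEquiv.toLp 2 (Fin 2 → ℝ)).symm.trans MeasurableEquiv.finTwoArrow with he
  have hmp : MeasurePreserving e volume volume :=
    (volume_preserving_finTwoArrow ℝ).comp
      (EuclideanSpace.volume_preserving_symm_measurableEquiv_toLp (Fin 2))
  have he1 : ∀ x : Plane, e x = (x 0, x 1) := fun x => rfl
  set D : Set (ℝ × ℝ) := {p | (√lam * p.1) ^ 2 + p.2 ^ 2 < b ^ 2} with hD
  have hDm : MeasurableSet D :=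
    (isOpen_lt (by fun_prop) continuous_const : IsOpen D).measurableSet
  have hpre : ellipseDomain (b / √lam) b = e ⁻¹' D := by
    ext x
    rw [mem_ellipseDomain, ellipseForm_stretched hlam.le, div_lt_one (by positivity)]
    rfl
  set f : ℝ × ℝ → ℝ := fun p => F (√lam * p.1) p.2 with hf
  have hint : IntegrableOn f D := by
    rw [hpre] at hF
    exact (hmp.integrableOn_comp_preimage e.measurableEmbedding).1 hF
  have h1 : ∫ x in ellipseDomain (b / √lam) b, F (√lam * x 0) (x 1) = ∫ p in D, f p := by
    rw [hpre]
    exact hmp.setIntegral_preimage_emb e.measurableEmbedding f D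
  have h2 : ∫ p in D, f p = ∫ x, ∫ y, D.indicator f (x, y) := by
    rw [← integral_indicator hDm]
    exact integral_prod _ ((integrable_indicator_iff hDm).2 hint)
  have h3 : ∀ x : ℝ, ∫ y, D.indicator f (x, y) =
      ∫ y in (-halfChord b (√lam * x))..halfChord b (√lam * x), F (√lam * x) y := by
    intro x
    have hset : ∀ y, D.indicator f (x, y) =
        (Ioo (-halfChord b (√lam * x)) (halfChord b (√lam * x))).indicator
          (fun y => F (√lam * x) y) y := by
      intro y
      have : (x, y) ∈ D ↔ y ∈ Ioo (-halfChord b (√lam * x)) (halfChord b (√lam * x)) := by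
        rw [halfChord, mem_Ioo, ← Real.sq_lt, lt_sub_iff_add_lt']
        rfl
      by_cases hy : (x, y) ∈ D
      · rw [indicator_of_mem hy, indicator_of_mem (this.1 hy)]
      · rw [indicator_of_notMem hy, indicator_of_notMem (mt this.2 hy)]
    simp only [hset]
    rw [integral_indicator measurableSet_Ioo, intervalIntegral.integral_of_le
      (by linarith [halfChord_nonneg b (√lam * x)]), integral_Ioc_eq_integral_Ioo]
  rw [h1, h2]
  simp only [h3]
  rw [Measure.integral_comp_mul_left
    (fun ξ => ∫ y in (-halfChord b ξ)..halfChord b ξ, F ξ y) √lam, abs_of_pos (inv_pos.2 hl),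
    smul_eq_mul, intervalIntegral.integral_eq_integral_of_support_subset]
  -- For `|ξ| ≥ b` the square root of a nonpositive number is `0`, so the chord integral vanishes
  -- and the integral over the line reduces to `[-b, b]`.
  intro ξ hξ
  by_contra hcon
  refine hξ ?_
  have h0 : halfChord b ξ = 0 := by
    refine Real.sqrt_eq_zero_of_nonpos ?_
    rw [mem_Ioc, not_and_or, not_lt, not_le] at hcon
    rcases hcon with h | h <;> nlinarith
  simp [h0]

theorem integral_two_mul_halfChord {b : ℝ} (hb : 0 < b) :
    ∫ ξ in (-b)..b, 2 * halfChord b ξ = Real.pi * b ^ 2 := by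
  have h := intervalIntegral.integral_comp_mul_left (a := -1) (b := 1)
    (fun ξ => 2 * halfChord b ξ) hb.ne'
  have h1 : ∀ x : ℝ, 2 * halfChord b (b * x) = 2 * b * √(1 - x ^ 2) := fun x => by
    rw [halfChord, show b ^ 2 - (b * x) ^ 2 = b ^ 2 * (1 - x ^ 2) by ring,
      Real.sqrt_mul (sq_nonneg b), Real.sqrt_sq hb.le]
    ring
  simp only [h1, intervalIntegral.integral_const_mul, integral_sqrt_one_sub_sq, smul_eq_mul,
    mul_neg, mul_one] at h
  rw [eq_inv_mul_iff_mul_eq₀ hb.ne'] at h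
  rw [intervalIntegral.integral_const_mul, ← h]
  ring

theorem average_stretched {b lam : ℝ} (hb : 0 < b) (hlam : 0 < lam) {F : ℝ → ℝ → ℝ}
    (hF : IntegrableOn (fun x : Plane => F (√lam * x 0) (x 1)) (ellipseDomain (b / √lam) b)) :
    ⨍ x in ellipseDomain (b / √lam) b, F (√lam * x 0) (x 1) =
      (Real.pi * b ^ 2)⁻¹ *
        ∫ ξ in (-b)..b, ∫ y in (-halfChord b ξ)..halfChord b ξ, F ξ y := by
  have hl : 0 < √lam := Real.sqrt_pos.2 hlam
  have hvol : volume.real (ellipseDomain (b / √lam) b) = (√lam)⁻¹ * (Real.pi * b ^ 2) := by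
    -- The area comes from the same change of variables, so the Jacobian `1 / √λ` cancels in the
    -- average.
    have h := setIntegral_stretched hb hlam (F := fun _ _ => 1)
      (integrableOn_const (volume_ellipseDomain_ne_top (by positivity) hb))
    simp only [setIntegral_const, smul_eq_mul, mul_one, intervalIntegral.integral_const,
      sub_neg_eq_add, ← two_mul] at h
    rw [h, integral_two_mul_halfChord hb]
  rw [setAverage_eq, hvol, setIntegral_stretched hb hlam hF, smul_eq_mul]
  field_simp

/-! ### Chord averages and the two terms of the expansion -/

/-- The profile `h sech (s h) / s - sinh (s h) / s ^ 2` of the chord average of the correction. -/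
noncomputable def chordProfile (s h : ℝ) : ℝ :=
  h / (s * Real.cosh (s * h)) - Real.sinh (s * h) / s ^ 2

theorem continuous_chordProfile_halfChord (b : ℝ) {s : ℝ} (hs : 0 < s) :
    Continuous fun ξ => chordProfile s (halfChord b ξ) := by
  have hc := continuous_halfChord b
  unfold chordProfile
  refine Continuous.sub (hc.div (by fun_prop) fun ξ => ?_) (by fun_prop)
  have := Real.cosh_pos (s * halfChord b ξ)
  positivity

theorem integral_stretchedSolution {b s lam : ℝ} (hs : 0 < s) {ξ : ℝ} (hξ : ξ ∈ Icc (-b) b) :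
    ∫ y in (-halfChord b ξ)..halfChord b ξ, stretchedSolution b s lam ξ y =
      2 * halfChord b ξ / s ^ 2 - 2 / s ^ 3 * Real.tanh (s * halfChord b ξ) +
        lam * (sechProfile₂ b s ξ * chordProfile s (halfChord b ξ) / s ^ 3) := by
  set h := halfChord b ξ with hh
  have hsq : ξ ^ 2 + h ^ 2 = b ^ 2 := by rw [hh, halfChord_sq hξ]; ring
  set g := sechProfile b s ξ with hg
  set m := sechProfile₂ b s ξ with hm
  set k := tanhProfile b s ξ with hk
  have hderiv : ∀ y, HasDerivAt (fun y => y / s ^ 2 - g * (Real.sinh (s * y) / s ^ 3) +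
      lam / (2 * s ^ 3) * (m * (y * Real.cosh (s * y) / s - Real.sinh (s * y) / s ^ 2) -
        m * k * (Real.sinh (s * y) / s))) (stretchedSolution b s lam ξ y) y := by
    intro y
    have h1 : HasDerivAt (fun y : ℝ => s * y) s y := by
      simpa using (hasDerivAt_id y).const_mul s
    have h2 := ((hasDerivAt_id y).div_const (s ^ 2)).sub
      ((h1.sinh.div_const (s ^ 3)).const_mul g)
    have h3 := (((((hasDerivAt_id y).mul h1.cosh).div_const s).sub
      (h1.sinh.div_const (s ^ 2))).const_mul m).sub ((h1.sinh.div_const s).const_mul (m * k))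
    refine (h2.add (h3.const_mul (lam / (2 * s ^ 3)))).congr_deriv ?_
    simp only [stretchedSolution, ← hg, ← hm, ← hk, id]
    field_simp
    ring
  have hcont : Continuous fun y => stretchedSolution b s lam ξ y := by
    unfold stretchedSolution
    fun_prop
  have hc := (Real.cosh_pos (s * h)).ne'
  rw [intervalIntegral.integral_eq_sub_of_hasDerivAt (fun y _ => hderiv y)
    (hcont.intervalIntegrable _ _), hg, hk, sechProfile_of_sq_add_sq hsq,
    tanhProfile_of_sq_add_sq hsq, chordProfile, Real.tanh_eq_sinh_div_cosh, mul_neg,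
    Real.sinh_neg, Real.cosh_neg]
  field_simp
  -- The terms `h cosh - h sinh² / cosh` combine to `h / cosh`, which produces `chordProfile`.
  have hid := Real.cosh_sq (s * h)
  ring_nf
  simp only [hid]
  ring

/-- The leading term of the Laplace transform of the heat content. -/
noncomputable def leadingTerm (b s : ℝ) : ℝ :=
  1 / s ^ 2 - 2 / (Real.pi * b ^ 2 * s ^ 3) * ∫ ξ in (-b)..b, Real.tanh (s * halfChord b ξ)

/-- The term of first order of the Laplace transform of the heat content. -/
noncomputable def correctionTerm (b s : ℝ) : ℝ :=
  -(1 / (Real.pi * b ^ 2 * s ^ 3) * ∫ ξ in (-b)..b,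
    (ξ ^ 2 / halfChord b ξ ^ 2 + 1 / 3) * Real.tanh (s * halfChord b ξ) ^ 3)

theorem continuous_tanh : Continuous Real.tanh := by
  have : Real.tanh = fun x => Real.sinh x / Real.cosh x := funext Real.tanh_eq_sinh_div_cosh
  rw [this]
  exact Real.continuous_sinh.div Real.continuous_cosh fun x => (Real.cosh_pos x).ne'

theorem hasDerivAt_tanh (x : ℝ) : HasDerivAt Real.tanh (1 / Real.cosh x ^ 2) x := by
  have : Real.tanh = fun x => Real.sinh x / Real.cosh x := funext Real.tanh_eq_sinh_div_cosh
  rw [this]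
  refine ((Real.hasDerivAt_sinh x).div (Real.hasDerivAt_cosh x)
    (Real.cosh_pos x).ne').congr_deriv ?_
  rw [← Real.cosh_sq_sub_sinh_sq x]
  ring

theorem tanh_nonneg {x : ℝ} (hx : 0 ≤ x) : 0 ≤ Real.tanh x := by
  rw [Real.tanh_eq_sinh_div_cosh]
  exact div_nonneg (Real.sinh_nonneg_iff.2 hx) (Real.cosh_pos x).le

theorem tanh_le_one (x : ℝ) : Real.tanh x ≤ 1 := by
  rw [Real.tanh_eq_sinh_div_cosh, div_le_one (Real.cosh_pos x)]
  exact (Real.sinh_lt_cosh x).le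

theorem tanh_le_self {x : ℝ} (hx : 0 ≤ x) : Real.tanh x ≤ x := by
  have hmono : MonotoneOn (fun x => x - Real.tanh x) (Ici 0) := by
    refine monotoneOn_of_deriv_nonneg (convex_Ici 0)
      (continuous_id.sub continuous_tanh).continuousOn
      (fun x _ => ((hasDerivAt_id x).sub
        (hasDerivAt_tanh x)).differentiableAt.differentiableWithinAt) fun x _ => ?_
    have : HasDerivAt (fun x => x - Real.tanh x) (1 - 1 / Real.cosh x ^ 2) x :=
      (hasDerivAt_id x).sub (hasDerivAt_tanh x)
    rw [this.deriv, sub_nonneg, div_le_one (by positivity)]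
    nlinarith [Real.one_le_cosh x]
  have := hmono self_mem_Ici hx hx
  simp only [Real.tanh_zero, sub_zero] at this
  linarith

theorem hasDerivAt_halfChord {b ξ : ℝ} (hξ : ξ ∈ Ioo (-b) b) :
    HasDerivAt (halfChord b) (-ξ / halfChord b ξ) ξ := by
  have h1 : HasDerivAt (fun ξ : ℝ => b ^ 2 - ξ ^ 2) (-(2 * ξ)) ξ := by
    simpa using (hasDerivAt_pow 2 ξ).const_sub (b ^ 2)
  have h0 : b ^ 2 - ξ ^ 2 ≠ 0 := by nlinarith [hξ.1, hξ.2]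
  refine (h1.sqrt h0).congr_deriv ?_
  rw [halfChord]
  field_simp

/-- The factor `1 / h²` is harmless at the tips: `tanh (s h) ≤ s h` and `tanh ≤ 1` give `tanh³ (s h)
≤ (s h)²`. -/
theorem intervalIntegrable_correction {b s : ℝ} (hb : 0 < b) (hs : 0 < s) :
    IntervalIntegrable (fun ξ => (ξ ^ 2 / halfChord b ξ ^ 2 + 1 / 3) *
      Real.tanh (s * halfChord b ξ) ^ 3) volume (-b) b := by
  have hc := continuous_halfChord b
  have ht : Continuous fun ξ => Real.tanh (s * halfChord b ξ) :=
    continuous_tanh.comp (by fun_prop)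
  rw [intervalIntegrable_iff_integrableOn_Ioo_of_le (by linarith)]
  refine Measure.integrableOn_of_bounded (M := b ^ 2 * s ^ 2 + 1 / 3) measure_Ioo_lt_top.ne ?_ ?_
  · refine Measurable.aestronglyMeasurable ?_
    have h1 := hc.measurable
    have h2 := ht.measurable
    fun_prop
  · refine (ae_restrict_mem measurableSet_Ioo).mono fun ξ hξ => ?_
    have hp := halfChord_pos hξ
    set h := halfChord b ξ
    have h0 : 0 ≤ Real.tanh (s * h) := tanh_nonneg (by positivity)
    have h1 := tanh_le_one (s * h)
    have h2 : Real.tanh (s * h) ≤ s * h := tanh_le_self (by positivity)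
    rw [Real.norm_eq_abs, abs_of_nonneg (by positivity), add_mul]
    have e1 : Real.tanh (s * h) ^ 3 ≤ (s * h) ^ 2 := by
      calc Real.tanh (s * h) ^ 3 = Real.tanh (s * h) ^ 2 * Real.tanh (s * h) := by ring
        _ ≤ (s * h) ^ 2 * 1 := by gcongr
        _ = _ := mul_one _
    have e2 : ξ ^ 2 ≤ b ^ 2 := by nlinarith [hξ.1, hξ.2]
    have e3 : ξ ^ 2 / h ^ 2 * Real.tanh (s * h) ^ 3 ≤ b ^ 2 * s ^ 2 := by
      calc ξ ^ 2 / h ^ 2 * Real.tanh (s * h) ^ 3 ≤ b ^ 2 / h ^ 2 * (s * h) ^ 2 := by gcongr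
        _ = b ^ 2 * s ^ 2 := by field_simp
    have e4 : Real.tanh (s * h) ^ 3 ≤ 1 := pow_le_one₀ h0 h1
    linarith

theorem hasDerivAt_sechProfile {b s ξ : ℝ} (hξ : ξ ∈ Ioo (-b) b) :
    HasDerivAt (sechProfile b s) (s * ξ * Real.sinh (s * halfChord b ξ) /
      (halfChord b ξ * Real.cosh (s * halfChord b ξ) ^ 2)) ξ := by
  have h1 := ((((hasDerivAt_halfChord hξ).const_mul s).cosh).inv (Real.cosh_pos _).ne')
  have h2 : sechProfile b s =ᶠ[𝓝 ξ] fun ξ => (Real.cosh (s * halfChord b ξ))⁻¹ := by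
    filter_upwards [Ioo_mem_nhds hξ.1 hξ.2] with η hη
    exact sechProfile_of_sq_add_sq (sq_add_sqrt_sq (Ioo_subset_Icc_self hη))
  refine (h1.congr_of_eventuallyEq h2).congr_deriv ?_
  have := (halfChord_pos hξ).ne'
  field_simp

/-- Integration by parts: with `Q` the chord profile, `g' Q'` equals `(ξ² / h²) tanh³ + (s ξ² / h)
tanh² sech²`, and adding the derivative of `ξ tanh³ / 3` cancels the second term and leaves `tanh³ /
3`. Both boundary terms vanish because `h = 0` at `ξ = ±b`. -/
theorem integral_sechProfile₂_mul_chordProfile {b s : ℝ} (hb : 0 < b) (hs : 0 < s) :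
    ∫ ξ in (-b)..b, sechProfile₂ b s ξ * chordProfile s (halfChord b ξ) =
      -∫ ξ in (-b)..b, (ξ ^ 2 / halfChord b ξ ^ 2 + 1 / 3) *
        Real.tanh (s * halfChord b ξ) ^ 3 := by
  have hU := isOpen_profileDomain b s
  have hc := continuous_halfChord b
  have ht : Continuous fun ξ => Real.tanh (s * halfChord b ξ) :=
    continuous_tanh.comp (by fun_prop)
  have hQ := continuous_chordProfile_halfChord b hs
  have hg' : ContinuousOn (deriv (sechProfile b s)) (Icc (-b) b) :=
    ((contDiffOn_sechProfile b s).continuousOn_deriv_of_isOpen hU (by simp)).mono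
      (Icc_subset_profileDomain b s)
  have hg'' : ContinuousOn (sechProfile₂ b s) (Icc (-b) b) :=
    (contDiffOn_sechProfile₂ b s).continuousOn.mono (Icc_subset_profileDomain b s)
  have hi1 : IntervalIntegrable (fun ξ => sechProfile₂ b s ξ * chordProfile s (halfChord b ξ))
      volume (-b) b := by
    refine ContinuousOn.intervalIntegrable ?_
    rw [uIcc_of_le (by linarith)]
    exact hg''.mul hQ.continuousOn
  have hi2 := intervalIntegrable_correction hb hs
  have hderiv : ∀ ξ ∈ Ioo (-b) b, HasDerivAt (fun ξ => deriv (sechProfile b s) ξ *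
      chordProfile s (halfChord b ξ) + ξ * Real.tanh (s * halfChord b ξ) ^ 3 / 3)
      (sechProfile₂ b s ξ * chordProfile s (halfChord b ξ) +
        (ξ ^ 2 / halfChord b ξ ^ 2 + 1 / 3) * Real.tanh (s * halfChord b ξ) ^ 3) ξ := by
    intro ξ hξ
    have hh := hasDerivAt_halfChord hξ
    have hpos := halfChord_pos hξ
    have hsh := hh.const_mul s
    have hC := Real.cosh_pos (s * halfChord b ξ)
    have h1 : HasDerivAt (deriv (sechProfile b s)) (sechProfile₂ b s ξ) ξ := by
      obtain ⟨f', hf', hf''⟩ := hasSecondDerivAt_of_contDiffOn hU (contDiffOn_sechProfile b s)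
        (Icc_subset_profileDomain b s (Ioo_subset_Icc_self hξ))
      refine hf''.congr_of_eventuallyEq ?_
      filter_upwards [hf'] with η hη using hη.deriv
    have h2 : HasDerivAt (fun ξ => chordProfile s (halfChord b ξ)) _ ξ :=
      (hh.div (hsh.cosh.const_mul s) (by positivity)).sub (hsh.sinh.div_const (s ^ 2))
    have h3 := (hasDerivAt_tanh (s * halfChord b ξ)).comp ξ hsh
    have h4 := ((hasDerivAt_id ξ).mul (h3.pow 3)).div_const 3
    refine ((h1.mul h2).add h4).congr_deriv ?_
    rw [(hasDerivAt_sechProfile hξ).deriv]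
    simp only [id, Nat.cast_ofNat, Nat.reduceSub, Pi.pow_apply, Function.comp_apply,
      Real.tanh_eq_sinh_div_cosh]
    have hid := Real.cosh_sq (s * halfChord b ξ)
    generalize Real.cosh (s * halfChord b ξ) = C at *
    generalize Real.sinh (s * halfChord b ξ) = S at *
    generalize halfChord b ξ = h at *
    field_simp
    linear_combination (3 * C * ξ ^ 2 * S) * hid
  -- Derivatives are needed only in the open interval; `halfChord` is merely continuous at the
  -- endpoints.
  have hFTC := intervalIntegral.integral_eq_sub_of_hasDerivAt_of_le (by linarith : -b ≤ b)
    (ContinuousOn.add (hg'.mul hQ.continuousOn)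
      (by fun_prop : Continuous fun ξ => ξ * Real.tanh (s * halfChord b ξ) ^ 3 / 3).continuousOn)
    hderiv (hi1.add hi2)
  rw [intervalIntegral.integral_add hi1 hi2] at hFTC
  have e1 : halfChord b b = 0 := by simp [halfChord]
  have e2 : halfChord b (-b) = 0 := by simp [halfChord]
  have e3 : chordProfile s 0 = 0 := by simp [chordProfile]
  rw [← sub_eq_zero, sub_neg_eq_add, hFTC]
  simp [e1, e2, e3]

theorem average_approxSolution {b s lam : ℝ} (hb : 0 < b) (hs : 0 < s) (hlam : 0 < lam) :
    ⨍ x in ellipseDomain (b / √lam) b, approxSolution b s lam x =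
      leadingTerm b s + lam * correctionTerm b s := by
  have hl : 0 < √lam := Real.sqrt_pos.2 hlam
  have hc := continuous_halfChord b
  have ht : Continuous fun ξ => Real.tanh (s * halfChord b ξ) :=
    continuous_tanh.comp (by fun_prop)
  have hQ := continuous_chordProfile_halfChord b hs
  have hg'' : ContinuousOn (sechProfile₂ b s) (Icc (-b) b) :=
    (contDiffOn_sechProfile₂ b s).continuousOn.mono (Icc_subset_profileDomain b s)
  have hi1 : IntervalIntegrable (fun ξ => sechProfile₂ b s ξ * chordProfile s (halfChord b ξ))
      volume (-b) b := by
    refine ContinuousOn.intervalIntegrable ?_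
    rw [uIcc_of_le (by linarith)]
    exact hg''.mul hQ.continuousOn
  have hint : IntegrableOn (fun x : Plane => stretchedSolution b s lam (√lam * x 0) (x 1))
      (ellipseDomain (b / √lam) b) := by
    refine (ContinuousOn.integrableOn_compact
      (isCompact_closure_ellipseDomain (by positivity) hb) ?_).mono_set subset_closure
    exact (continuousOn_stretchedSolution b s lam).comp
      (f := fun x : Plane => (√lam * x 0, x 1)) (by fun_prop) fun x hx =>
        ⟨(mem_Icc_of_sq_add_sq_le hb ((mem_closure_stretched hb hlam).1 hx)).1, trivial⟩
  have h := average_stretched hb hlam hint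
  have h1 : ∫ ξ in (-b)..b, ∫ y in (-halfChord b ξ)..halfChord b ξ,
      stretchedSolution b s lam ξ y = ∫ ξ in (-b)..b, ((2 * halfChord b ξ) / s ^ 2 -
        2 / s ^ 3 * Real.tanh (s * halfChord b ξ) +
        lam * (sechProfile₂ b s ξ * chordProfile s (halfChord b ξ) / s ^ 3)) := by
    refine intervalIntegral.integral_congr fun ξ hξ => ?_
    rw [uIcc_of_le (by linarith)] at hξ
    exact integral_stretchedSolution hs hξ
  have hi2 : IntervalIntegrable (fun ξ => (2 * halfChord b ξ) / s ^ 2) volume (-b) b :=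
    Continuous.intervalIntegrable (by fun_prop) _ _
  have hi3 : IntervalIntegrable (fun ξ => 2 / s ^ 3 * Real.tanh (s * halfChord b ξ))
      volume (-b) b := Continuous.intervalIntegrable (by fun_prop) _ _
  unfold approxSolution
  rw [h, h1, intervalIntegral.integral_add (hi2.sub hi3) ((hi1.div_const _).const_mul lam),
    intervalIntegral.integral_sub hi2 hi3, intervalIntegral.integral_const_mul,
    intervalIntegral.integral_const_mul, intervalIntegral.integral_div,
    intervalIntegral.integral_div, integral_two_mul_halfChord hb,
    integral_sechProfile₂_mul_chordProfile hb hs, leadingTerm, correctionTerm]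
  generalize (∫ ξ in (-b)..b, (ξ ^ 2 / halfChord b ξ ^ 2 + 1 / 3) *
    Real.tanh (s * halfChord b ξ) ^ 3) = I
  have := Real.pi_pos.ne'
  field_simp

/-! ### The one-dimensional integrals in the variable `h` -/

theorem halfChord_halfChord {b h : ℝ} (hh : h ∈ Ioo 0 b) : halfChord b (halfChord b h) = h := by
  rw [halfChord, halfChord_sq ⟨by linarith [hh.1, hh.2], hh.2.le⟩, sub_sub_cancel,
    Real.sqrt_sq hh.1.le]

theorem halfChord_mem_Ioo {b h : ℝ} (hh : h ∈ Ioo 0 b) : halfChord b h ∈ Ioo 0 b := by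
  have hb : 0 < b := hh.1.trans hh.2
  refine ⟨halfChord_pos ⟨by linarith [hh.1], hh.2⟩, ?_⟩
  rw [halfChord, Real.sqrt_lt' hb]
  nlinarith [hh.1]

/-- The map `ξ ↦ √(b² - ξ²)` is an involution of `(0, b)`, with Jacobian `h / √(b² - h²)`. -/
theorem setIntegral_comp_halfChord (b : ℝ) (φ : ℝ → ℝ) :
    ∫ ξ in Ioo 0 b, φ ξ = ∫ h in Ioo 0 b, h / halfChord b h * φ (halfChord b h) := by
  have himg : halfChord b '' Ioo 0 b = Ioo 0 b := by
    apply Subset.antisymm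
    · rintro _ ⟨h, hh, rfl⟩
      exact halfChord_mem_Ioo hh
    · exact fun h hh => ⟨halfChord b h, halfChord_mem_Ioo hh, halfChord_halfChord hh⟩
  have hinj : InjOn (halfChord b) (Ioo 0 b) := fun x hx y hy hxy => by
    rw [← halfChord_halfChord hx, hxy, halfChord_halfChord hy]
  have h := integral_image_eq_integral_abs_deriv_smul measurableSet_Ioo
    (fun x hx => (hasDerivAt_halfChord (b := b) (ξ := x)
      ⟨by linarith [hx.1, hx.2], hx.2⟩).hasDerivWithinAt) hinj φ
  rw [himg] at h
  rw [h]
  refine setIntegral_congr_fun measurableSet_Ioo fun x hx => ?_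
  simp only [smul_eq_mul]
  rw [neg_div, abs_neg, abs_of_nonneg (div_nonneg hx.1.le (halfChord_nonneg _ _))]

theorem integral_neg_self_of_even {b : ℝ} (hb : 0 ≤ b) {φ : ℝ → ℝ} (hφ : ∀ x, φ (-x) = φ x)
    (hint : IntervalIntegrable φ volume (-b) b) :
    ∫ ξ in (-b)..b, φ ξ = 2 * ∫ ξ in Ioo 0 b, φ ξ := by
  have h0 : (0 : ℝ) ∈ uIcc (-b) b := by rw [uIcc_of_le (by linarith)]; exact ⟨by linarith, hb⟩
  have h1 := intervalIntegral.integral_comp_neg (a := 0) (b := b) φ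
  simp only [hφ, neg_zero] at h1
  rw [← intervalIntegral.integral_add_adjacent_intervals
    (hint.mono_set (uIcc_subset_uIcc_left h0)) (hint.mono_set (uIcc_subset_uIcc_right h0)),
    ← h1, ← two_mul, intervalIntegral.integral_of_le hb, integral_Ioc_eq_integral_Ioo]

theorem halfChord_neg (b ξ : ℝ) : halfChord b (-ξ) = halfChord b ξ := by
  simp [halfChord]

theorem leadingTerm_eq {b : ℝ} (hb : 0 < b) (s : ℝ) :
    leadingTerm b s = 1 / s ^ 2 - 4 / (Real.pi * b ^ 2 * s ^ 3) *
      ∫ h in Ioo 0 b, h / halfChord b h * Real.tanh (s * h) := by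
  have hc := continuous_halfChord b
  have ht : Continuous fun ξ => Real.tanh (s * halfChord b ξ) :=
    continuous_tanh.comp (by fun_prop)
  rw [leadingTerm, integral_neg_self_of_even hb.le (fun ξ => by rw [halfChord_neg])
    (ht.intervalIntegrable _ _),
    setIntegral_comp_halfChord,
    setIntegral_congr_fun (g := fun h => h / halfChord b h * Real.tanh (s * h)) measurableSet_Ioo
      fun h hh => by simp only [halfChord_halfChord hh]]
  ring

theorem correctionTerm_eq {b s : ℝ} (hb : 0 < b) (hs : 0 < s) :
    correctionTerm b s = -(2 / (Real.pi * b ^ 2 * s ^ 3) *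
      ∫ h in Ioo 0 b, (halfChord b h / h + h / halfChord b h / 3) * Real.tanh (s * h) ^ 3) := by
  rw [correctionTerm, integral_neg_self_of_even hb.le (fun ξ => by rw [halfChord_neg, neg_sq])
    (intervalIntegrable_correction hb hs), setIntegral_comp_halfChord,
    setIntegral_congr_fun (g := fun h => (halfChord b h / h + h / halfChord b h / 3) *
      Real.tanh (s * h) ^ 3) measurableSet_Ioo fun h hh => by
        simp only [halfChord_halfChord hh]
        have h1 := (halfChord_mem_Ioo hh).1
        have h2 := hh.1
        field_simp]
  ring

/-! ### Watson's lemma -/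

theorem integrableOn_pow_mul_exp_neg (n : ℕ) {c : ℝ} (hc : 0 < c) :
    IntegrableOn (fun x : ℝ => x ^ n * Real.exp (-(c * x))) (Ioi 0) := by
  have h := integrableOn_rpow_mul_exp_neg_mul_rpow (p := 1) (s := n) (b := c)
    (by have : (0 : ℝ) ≤ n := n.cast_nonneg
        linarith) one_pos hc
  simpa using h

theorem integral_pow_mul_exp_neg (n : ℕ) {c : ℝ} (hc : 0 < c) :
    ∫ x in Ioi (0 : ℝ), x ^ n * Real.exp (-(c * x)) = n.factorial / c ^ (n + 1) := by
  have h := Real.integral_rpow_mul_exp_neg_mul_Ioi (a := n + 1) (r := c) (by positivity) hc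
  rw [Real.Gamma_nat_eq_factorial] at h
  have e : ((n : ℝ) + 1) = ((n + 1 : ℕ) : ℝ) := by push_cast; rfl
  rw [add_sub_cancel_right, e, Real.rpow_natCast] at h
  simp only [Real.rpow_natCast] at h
  rw [h, one_div, inv_pow]
  ring

/-- The odd moments of `G` on the half-line. -/
noncomputable def oddMoment (G : ℝ → ℝ) (k : ℕ) : ℝ := ∫ x in Ioi (0 : ℝ), x ^ (2 * k + 1) * G x

theorem integrableOn_pow_mul_comp_mul {G : ℝ → ℝ} {C s : ℝ} (hs : 0 < s) (hG : Continuous G)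
    (hGle : ∀ x > 0, |G x| ≤ C * Real.exp (-(2 * x))) (n : ℕ) :
    IntegrableOn (fun h => h ^ n * G (s * h)) (Ioi 0) := by
  refine ((integrableOn_pow_mul_exp_neg n (c := 2 * s) (by positivity)).const_mul C).mono'
    (by fun_prop) ((ae_restrict_mem measurableSet_Ioi).mono fun h hh => ?_)
  have hh : 0 < h := hh
  rw [norm_mul, Real.norm_eq_abs, Real.norm_eq_abs, abs_of_nonneg (by positivity)]
  calc h ^ n * |G (s * h)| ≤ h ^ n * (C * Real.exp (-(2 * (s * h)))) := by
        gcongr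
        exact hGle _ (by positivity)
    _ = C * (h ^ n * Real.exp (-(2 * s * h))) := by rw [mul_assoc 2 s h]; ring

theorem integral_pow_mul_comp_mul (G : ℝ → ℝ) {s : ℝ} (hs : 0 < s) (k : ℕ) :
    ∫ h in Ioi (0 : ℝ), h ^ (2 * k + 1) * G (s * h) = oddMoment G k / s ^ (2 * k + 2) := by
  have h := integral_comp_mul_left_Ioi (fun x => x ^ (2 * k + 1) * G x) 0 hs
  simp only [mul_zero, mul_pow, smul_eq_mul, mul_assoc, integral_const_mul] at h
  rw [oddMoment, eq_div_iff (by positivity), pow_succ s (2 * k + 1)]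
  field_simp at h
  linarith

theorem integrableOn_mul_comp_mul {P G : ℝ → ℝ} {b s M : ℝ} (hP : IntegrableOn P (Ioo 0 b))
    (hG : Continuous G) (hM : ∀ h ∈ Ioo 0 b, |G (s * h)| ≤ M) :
    IntegrableOn (fun h => P h * G (s * h)) (Ioo 0 b) := by
  refine (hP.norm.const_mul M).mono' (hP.aestronglyMeasurable.mul (by fun_prop))
    ((ae_restrict_mem measurableSet_Ioo).mono fun h hh => ?_)
  rw [norm_mul, mul_comm M]
  gcongr
  exact hM h hh

/-- Watson's lemma for weights with an expansion in odd powers. -/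
theorem isBigO_watson {P G : ℝ → ℝ} {p : ℕ → ℝ} {b C : ℝ} (hb : 0 < b)
    (hP : IntegrableOn P (Ioo 0 b)) (hG : Continuous G)
    (hGle : ∀ x > 0, |G x| ≤ C * Real.exp (-(2 * x))) (K : ℕ)
    (hPK : (fun h => P h - ∑ k ∈ Finset.range K, p k * h ^ (2 * k + 1)) =O[𝓝[>] 0]
      fun h => h ^ (2 * K + 1)) :
    (fun s => (∫ h in Ioo 0 b, P h * G (s * h)) -
      ∑ k ∈ Finset.range K, p k * oddMoment G k / s ^ (2 * k + 2)) =O[atTop]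
      fun s : ℝ => (s ^ (2 * K + 2))⁻¹ := by
  have hC : 0 ≤ C := by
    have := (abs_nonneg _).trans (hGle 1 one_pos)
    exact nonneg_of_mul_nonneg_left this (Real.exp_pos _)
  obtain ⟨A, hA⟩ := hPK.bound
  obtain ⟨δ₀, hδ₀, hδA⟩ := mem_nhdsGT_iff_exists_Ioo_subset.1 hA
  have hδ₀ : 0 < δ₀ := hδ₀
  set Pe : ℝ → ℝ := (Ioo 0 b).indicator P with hPe
  set δ : ℝ := min δ₀ b with hδdef
  have hδ : 0 < δ := lt_min hδ₀ hb
  -- For `h ≥ δ` each lower power satisfies `h ^ (2k+1) ≤ h ^ (2K+1) / δ ^ (2(K-k))`, so `B h ^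
  -- (2K+1)` dominates the partial sum.
  set B : ℝ := ∑ k ∈ Finset.range K, |p k| / δ ^ (2 * (K - k)) with hB
  have hB0 : 0 ≤ B := Finset.sum_nonneg fun k _ => by positivity
  set D : ℝ → ℝ := fun h => Pe h - ∑ k ∈ Finset.range K, p k * h ^ (2 * k + 1) with hDdef
  have hPeint : IntegrableOn Pe (Ioi 0) :=
    ((integrable_indicator_iff measurableSet_Ioo).2 hP).integrableOn
  have hD : ∀ h > 0, ∀ s > 0, |D h * G (s * h)| ≤
      (|A| + B) * C * (h ^ (2 * K + 1) * Real.exp (-(2 * s * h))) +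
        C * Real.exp (-(2 * s * δ)) * |Pe h| := by
    intro h hh s hs
    have hGs : |G (s * h)| ≤ C * Real.exp (-(2 * s * h)) := by
      rw [mul_assoc]; exact hGle _ (by positivity)
    rw [abs_mul]
    -- Below `δ` the expansion of the weight applies. Above it, integrability of `P` and the factor
    -- `e^{-2sδ}` from `G` suffice.
    by_cases hlt : h < δ
    · have h1 : |D h| ≤ |A| * h ^ (2 * K + 1) := by
        have h2 := hδA ⟨hh, hlt.trans_le (min_le_left _ _)⟩
        simp only [hDdef]
        rw [hPe, indicator_of_mem (show h ∈ Ioo 0 b from ⟨hh, hlt.trans_le (min_le_right _ _)⟩)]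
        simp only [mem_ofPred_eq, Real.norm_eq_abs] at h2
        refine h2.trans ?_
        rw [abs_of_nonneg (by positivity : 0 ≤ h ^ (2 * K + 1))]
        gcongr
        exact le_abs_self A
      calc _ ≤ |A| * h ^ (2 * K + 1) * (C * Real.exp (-(2 * s * h))) := by gcongr
        _ ≤ (|A| + B) * C * (h ^ (2 * K + 1) * Real.exp (-(2 * s * h))) := by
            have : 0 ≤ B * (h ^ (2 * K + 1) * (C * Real.exp (-(2 * s * h)))) := by positivity
            linarith
        _ ≤ _ := le_add_of_nonneg_right (by positivity)
    · push Not at hlt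
      have h1 : |D h| ≤ |Pe h| + B * h ^ (2 * K + 1) := by
        refine (abs_sub _ _).trans (add_le_add le_rfl ?_)
        rw [hB, Finset.sum_mul]
        refine (Finset.abs_sum_le_sum_abs _ _).trans (Finset.sum_le_sum fun k hk => ?_)
        have hk := Finset.mem_range.1 hk
        rw [abs_mul, abs_of_nonneg (by positivity : 0 ≤ h ^ (2 * k + 1)), div_mul_eq_mul_div,
          le_div_iff₀ (by positivity), mul_assoc,
          show 2 * K + 1 = (2 * k + 1) + 2 * (K - k) by omega, pow_add h (2 * k + 1)]
        gcongr
      calc _ ≤ (|Pe h| + B * h ^ (2 * K + 1)) * (C * Real.exp (-(2 * s * h))) := by gcongr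
        _ = B * C * (h ^ (2 * K + 1) * Real.exp (-(2 * s * h))) +
            C * Real.exp (-(2 * s * h)) * |Pe h| := by ring
        _ ≤ _ := by
            gcongr
            exact le_add_of_nonneg_left (abs_nonneg A)
  set J : ℝ := ∫ h in Ioi 0, |Pe h| with hJ
  have hJ0 : 0 ≤ J := integral_nonneg fun h => abs_nonneg _
  set n := 2 * K + 2 with hn
  refine IsBigO.of_bound ((|A| + B) * C * ((2 * K + 1).factorial / 2 ^ n) +
    C * (n.factorial / (2 * δ) ^ n) * J) ?_
  filter_upwards [eventually_gt_atTop 0] with s hs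
  have hPG : IntegrableOn (fun h => P h * G (s * h)) (Ioo 0 b) := by
    refine integrableOn_mul_comp_mul (M := C) hP hG fun h hh => ?_
    refine (hGle _ (mul_pos hs hh.1)).trans (mul_le_of_le_one_right hC (Real.exp_le_one_iff.2 ?_))
    have := mul_pos hs hh.1
    linarith
  have hind : ∀ h, Pe h * G (s * h) = (Ioo 0 b).indicator (fun h => P h * G (s * h)) h :=
    fun h => by
      by_cases hh : h ∈ Ioo 0 b
      · simp only [hPe, indicator_of_mem hh]
      · simp only [hPe, indicator_of_notMem hh, zero_mul]
  have hPeG : IntegrableOn (fun h => Pe h * G (s * h)) (Ioi 0) := by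
    simp only [hind]
    exact ((integrable_indicator_iff measurableSet_Ioo).2 hPG).integrableOn
  have hPeG' : ∫ h in Ioi 0, Pe h * G (s * h) = ∫ h in Ioo 0 b, P h * G (s * h) := by
    simp only [hind]
    rw [setIntegral_indicator measurableSet_Ioo, inter_eq_right.2 fun h hh => hh.1]
  have hterm : ∀ k ∈ Finset.range K,
      IntegrableOn (fun h => p k * (h ^ (2 * k + 1) * G (s * h))) (Ioi 0) := fun k _ =>
    (integrableOn_pow_mul_comp_mul hs hG hGle _).const_mul _
  have heq : (∫ h in Ioo 0 b, P h * G (s * h)) -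
      ∑ k ∈ Finset.range K, p k * oddMoment G k / s ^ (2 * k + 2) =
      ∫ h in Ioi 0, D h * G (s * h) := by
    have h1 : ∀ h, D h * G (s * h) = Pe h * G (s * h) -
        ∑ k ∈ Finset.range K, p k * (h ^ (2 * k + 1) * G (s * h)) := fun h => by
      simp only [hDdef, sub_mul, Finset.sum_mul, mul_assoc]
    simp only [h1]
    rw [integral_sub hPeG (integrable_finsetSum _ hterm), hPeG', integral_finsetSum _ hterm]
    congr 1
    refine Finset.sum_congr rfl fun k _ => ?_
    rw [integral_const_mul, integral_pow_mul_comp_mul G hs, mul_div_assoc]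
  have hi := integrableOn_pow_mul_exp_neg (2 * K + 1) (c := 2 * s) (by positivity)
  have hbound := norm_integral_le_of_norm_le (f := fun h => D h * G (s * h))
    ((hi.const_mul ((|A| + B) * C)).add (hPeint.norm.const_mul (C * Real.exp (-(2 * s * δ)))))
    ((ae_restrict_mem measurableSet_Ioi).mono fun h hh => hD h hh s hs)
  rw [heq]
  refine (hbound.trans_eq (integral_add' (hi.const_mul ((|A| + B) * C))
    (hPeint.norm.const_mul (C * Real.exp (-(2 * s * δ)))))).trans ?_
  rw [integral_const_mul, integral_const_mul, integral_pow_mul_exp_neg _ (by positivity)]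
  simp only [Real.norm_eq_abs, ← hJ]
  have hexp : Real.exp (-(2 * s * δ)) ≤ n.factorial / (2 * δ) ^ n * (s ^ n)⁻¹ := by
    have h1 := Real.pow_div_factorial_le_exp (2 * s * δ) (by positivity) n
    rw [Real.exp_neg, inv_le_comm₀ (Real.exp_pos _) (by positivity)]
    refine le_of_eq_of_le ?_ h1
    rw [mul_inv, inv_inv, inv_div, mul_right_comm 2 s δ, mul_pow (2 * δ) s]
    ring
  rw [abs_of_nonneg (by positivity : 0 ≤ (s ^ n)⁻¹), add_mul (_ * _) _ (s ^ n)⁻¹]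
  refine add_le_add (le_of_eq ?_) ?_
  · rw [show 2 * K + 1 + 1 = n from rfl, mul_pow]
    field_simp
  · calc C * Real.exp (-(2 * s * δ)) * J ≤ C * (n.factorial / (2 * δ) ^ n * (s ^ n)⁻¹) * J := by
          gcongr
      _ = _ := by ring

/-! ### Weyl series -/

/-- The coefficients of a Weyl series with leading terms `c₂ / s ^ 2 + c₃ / s ^ 3`, followed by
the terms `d k / s ^ (2 k + 5)`. -/
noncomputable def oddWeylCoeff (c₂ c₃ : ℝ) (d : ℕ → ℝ) (n : ℕ) : ℝ :=
  if n = 2 then c₂ else if n = 3 then c₃ else if Odd n ∧ 5 ≤ n then d ((n - 5) / 2) else 0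

theorem oddWeylCoeff_odd (c₂ c₃ : ℝ) (d : ℕ → ℝ) (k : ℕ) :
    oddWeylCoeff c₂ c₃ d (2 * k + 5) = d k := by
  rw [oddWeylCoeff, if_neg (by omega), if_neg (by omega), if_pos ⟨⟨k + 2, by ring⟩, by omega⟩]
  congr
  omega

theorem oddWeylCoeff_even (c₂ c₃ : ℝ) (d : ℕ → ℝ) {n : ℕ} (hn : 4 ≤ n) (he : Even n) :
    oddWeylCoeff c₂ c₃ d n = 0 := by
  rw [oddWeylCoeff, if_neg (by omega), if_neg (by omega), if_neg]
  exact fun h => (Nat.not_odd_iff_even.2 he) h.1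

theorem sum_oddWeylCoeff (c₂ c₃ : ℝ) (d : ℕ → ℝ) (s : ℝ) (K : ℕ) :
    ∑ n ∈ Finset.Icc 2 (2 * K + 4), oddWeylCoeff c₂ c₃ d n / s ^ n =
      c₂ / s ^ 2 + c₃ / s ^ 3 + ∑ k ∈ Finset.range K, d k / s ^ (2 * k + 5) := by
  induction K with
  | zero =>
    have h4 : oddWeylCoeff c₂ c₃ d 4 = 0 := oddWeylCoeff_even _ _ _ le_rfl (by decide)
    rw [show Finset.Icc 2 (2 * 0 + 4) = {2, 3, 4} by decide, Finset.sum_insert (by decide),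
      Finset.sum_insert (by decide), Finset.sum_singleton, h4]
    simp [oddWeylCoeff]
  | succ K ih =>
    rw [show 2 * (K + 1) + 4 = 2 * K + 4 + 1 + 1 by ring, Finset.sum_Icc_succ_top (by omega),
      Finset.sum_Icc_succ_top (by omega), ih, Finset.sum_range_succ,
      oddWeylCoeff_even _ _ _ (n := 2 * K + 4 + 1 + 1) (by omega) ⟨K + 3, by ring⟩,
      show 2 * K + 4 + 1 = 2 * K + 5 by ring, oddWeylCoeff_odd]
    ring

theorem isLittleO_inv_pow {m n : ℕ} (h : m < n) :
    (fun s : ℝ => (s ^ n)⁻¹) =o[atTop] fun s : ℝ => (s ^ m)⁻¹ := by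
  have h1 : (fun s : ℝ => s ^ m) =o[atTop] fun s : ℝ => s ^ n := isLittleO_pow_pow_atTop_of_lt h
  refine h1.inv_rev ?_
  filter_upwards [eventually_gt_atTop 0] with s hs h0
  exact absurd h0 (by positivity)

/-- For order `N`, take `K = N`: the sum then runs past `N`, and the remainder and the finitely many
extra terms are all `o(s^{-N})`. -/
theorem hasWeylSeries_oddWeylCoeff {F : ℝ → ℝ} {c₂ c₃ : ℝ} {d : ℕ → ℝ}
    (h : ∀ K, (fun s => F s - (c₂ / s ^ 2 + c₃ / s ^ 3 +
      ∑ k ∈ Finset.range K, d k / s ^ (2 * k + 5))) =O[atTop] fun s : ℝ => (s ^ (2 * K + 5))⁻¹) :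
    HasWeylSeries F (oddWeylCoeff c₂ c₃ d) := by
  intro N
  have h1 := h N
  simp only [← sum_oddWeylCoeff] at h1
  have h2 : (fun s : ℝ => ∑ n ∈ Finset.Icc 2 (2 * N + 4) \ Finset.Icc 2 N,
      oddWeylCoeff c₂ c₃ d n / s ^ n) =o[atTop] fun s : ℝ => (s ^ N)⁻¹ := by
    refine IsLittleO.fun_sum fun n hn => ?_
    simp only [Finset.mem_sdiff, Finset.mem_Icc] at hn
    simp only [div_eq_mul_inv]
    exact (isLittleO_inv_pow (by omega)).const_mul_left _
  have h3 := (h1.trans_isLittleO (isLittleO_inv_pow (show N < 2 * N + 5 by omega))).add h2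
  refine h3.congr_left fun s => ?_
  rw [← Finset.sum_sdiff (Finset.Icc_subset_Icc_right (show N ≤ 2 * N + 4 by omega))]
  ring

/-! ### Expansions of the weights -/

/-- The Taylor coefficients of `1 / √(1 - x)`. -/
noncomputable def invSqrtCoeff (k : ℕ) : ℝ := Ring.choose (1 / 2 + (k : ℝ) - 1) k

theorem isBigO_invSqrt (K : ℕ) :
    (fun x : ℝ => 1 / √(1 - x) - ∑ k ∈ Finset.range K, invSqrtCoeff k * x ^ k) =O[𝓝 0]
      fun x => x ^ K := by
  have h := (Real.one_div_one_sub_rpow_hasFPowerSeriesOnBall_zero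
    (1 / 2)).hasFPowerSeriesAt.isBigO_sub_partialSum_pow K
  refine (h.trans (isBigO_of_le _ fun x => ?_)).congr_left fun x => ?_
  · simp
  · simp only [FormalMultilinearSeries.partialSum, FormalMultilinearSeries.ofScalars_apply_eq,
      zero_add, Real.sqrt_eq_rpow, smul_eq_mul, invSqrtCoeff]

theorem tendsto_div_sq_nhdsGT (b : ℝ) : Tendsto (fun h : ℝ => (h / b) ^ 2) (𝓝[>] 0) (𝓝 0) := by
  have : Continuous fun h : ℝ => (h / b) ^ 2 := by fun_prop
  simpa using (this.tendsto 0).mono_left nhdsWithin_le_nhds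

theorem halfChord_eq_mul_sqrt {b : ℝ} (hb : 0 < b) (h : ℝ) :
    halfChord b h = b * √(1 - (h / b) ^ 2) := by
  rw [halfChord, show b ^ 2 - h ^ 2 = b ^ 2 * (1 - (h / b) ^ 2) by field_simp,
    Real.sqrt_mul (sq_nonneg b), Real.sqrt_sq hb.le]

/-- The weight of the leading term. -/
noncomputable def leadingWeight (b h : ℝ) : ℝ := h / halfChord b h

/-- The regular part of the weight of the correction term. -/
noncomputable def correctionWeight (b h : ℝ) : ℝ :=
  (halfChord b h - b) / h + h / halfChord b h / 3

theorem isBigO_leadingWeight {b : ℝ} (hb : 0 < b) (K : ℕ) :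
    (fun h => leadingWeight b h - ∑ k ∈ Finset.range K,
      invSqrtCoeff k / b ^ (2 * k + 1) * h ^ (2 * k + 1)) =O[𝓝[>] 0]
        fun h => h ^ (2 * K + 1) := by
  have h1 := (isBigO_invSqrt K).comp_tendsto (tendsto_div_sq_nhdsGT b)
  have h2 := (isBigO_refl (fun h : ℝ => h / b) (𝓝[>] 0)).mul h1
  have h3 : (fun h : ℝ => h / b * ((h / b) ^ 2) ^ K) =O[𝓝[>] 0] fun h => h ^ (2 * K + 1) := by
    refine (isBigO_refl (fun h : ℝ => h ^ (2 * K + 1)) _).const_mul_left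
      ((b ^ (2 * K + 1))⁻¹) |>.congr_left fun h => ?_
    rw [← pow_mul, ← pow_succ', div_pow]
    ring
  refine (h2.trans h3).congr_left fun h => ?_
  simp only [Function.comp_apply, leadingWeight]
  rw [halfChord_eq_mul_sqrt hb, mul_sub, Finset.mul_sum]
  congr 1
  · rw [mul_one_div, div_div]
  · refine Finset.sum_congr rfl fun k _ => ?_
    rw [← pow_mul, mul_left_comm, ← pow_succ', div_pow]
    ring

/-- Write `√(1 - q) = (1 - q) / √(1 - q)` with `q = (h / b)²`, so the coefficients of the square
root are differences of `invSqrtCoeff`. The constant term cancels against `-b`, and the factor `b /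
h` costs one power of `h`, which is why one more term of the series is used. -/
theorem isBigO_correctionWeight {b : ℝ} (hb : 0 < b) (K : ℕ) :
    (fun h => correctionWeight b h - ∑ k ∈ Finset.range K,
      (invSqrtCoeff (k + 1) - invSqrtCoeff k + invSqrtCoeff k / 3) / b ^ (2 * k + 1) *
        h ^ (2 * k + 1)) =O[𝓝[>] 0] fun h => h ^ (2 * K + 1) := by
  have hK := (isBigO_leadingWeight hb K).const_mul_left (1 / 3)
  have h0 : invSqrtCoeff 0 = 1 := by simp [invSqrtCoeff]
  set q : ℝ → ℝ := fun h => (h / b) ^ 2 with hq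
  set R : ℝ → ℝ := fun h => 1 / √(1 - q h) - ∑ k ∈ Finset.range (K + 1),
    invSqrtCoeff k * q h ^ k with hR
  have hone : Tendsto (fun h => 1 - q h) (𝓝[>] 0) (𝓝 1) := by
    simpa using (tendsto_div_sq_nhdsGT b).const_sub 1
  have h1 : R =O[𝓝[>] 0] fun h => q h ^ (K + 1) :=
    (isBigO_invSqrt (K + 1)).comp_tendsto (tendsto_div_sq_nhdsGT b)
  have h2 : (fun h => b / h * ((1 - q h) * R h - invSqrtCoeff K * q h ^ (K + 1))) =O[𝓝[>] 0]
      fun h => h ^ (2 * K + 1) := by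
    have e1 : (fun h => (1 - q h) * R h) =O[𝓝[>] 0] fun h => q h ^ (K + 1) := by
      have := (hone.isBigO_one ℝ).mul h1
      simpa using this
    have e2 := (isBigO_refl (fun h : ℝ => b / h) (𝓝[>] 0)).mul
      (e1.sub ((isBigO_refl (fun h => q h ^ (K + 1)) (𝓝[>] 0)).const_mul_left (invSqrtCoeff K)))
    refine e2.trans (IsBigO.of_bound (b / b ^ (2 * K + 2)) ?_)
    filter_upwards [self_mem_nhdsWithin] with h hh
    have hh : 0 < h := hh
    rw [Real.norm_of_nonneg (by positivity), Real.norm_of_nonneg (by positivity)]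
    simp only [hq]
    rw [← pow_mul, div_pow, show 2 * (K + 1) = 2 * K + 1 + 1 by ring, pow_succ h]
    field_simp
    exact le_rfl
  refine (h2.add hK).congr' ?_ EventuallyEq.rfl
  filter_upwards [Ioo_mem_nhdsGT hb] with h hh
  have hqpos : 0 < 1 - q h := by
    have : (h / b) ^ 2 < 1 := by
      rw [div_pow, div_lt_one (by positivity)]
      nlinarith [hh.1, hh.2]
    simp only [hq]
    linarith
  have hsq : (1 - q h) * (1 / √(1 - q h)) = √(1 - q h) := by
    rw [mul_one_div, Real.div_sqrt]
  have htel : ∀ x : ℝ, (1 - x) * ∑ k ∈ Finset.range (K + 1), invSqrtCoeff k * x ^ k =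
      1 + ∑ k ∈ Finset.range K, (invSqrtCoeff (k + 1) - invSqrtCoeff k) * x ^ (k + 1) -
        invSqrtCoeff K * x ^ (K + 1) := fun x => by
    rw [sub_mul, one_mul, Finset.mul_sum]
    nth_rewrite 1 [Finset.sum_range_succ']
    rw [Finset.sum_range_succ]
    simp only [sub_mul, Finset.sum_sub_distrib, h0, pow_zero]
    have : ∀ k, x * (invSqrtCoeff k * x ^ k) = invSqrtCoeff k * x ^ (k + 1) := fun k => by ring
    simp only [this]
    ring
  have hmain : b / h * ((1 - q h) * R h - invSqrtCoeff K * q h ^ (K + 1)) =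
      (halfChord b h - b) / h - ∑ k ∈ Finset.range K,
        (invSqrtCoeff (k + 1) - invSqrtCoeff k) / b ^ (2 * k + 1) * h ^ (2 * k + 1) := by
    simp only [hR]
    rw [mul_sub (1 - q h), hsq, htel, halfChord_eq_mul_sqrt hb, show (h / b) ^ 2 = q h from rfl]
    have hsum : ∑ k ∈ Finset.range K,
        (invSqrtCoeff (k + 1) - invSqrtCoeff k) / b ^ (2 * k + 1) * h ^ (2 * k + 1) =
        b / h * ∑ k ∈ Finset.range K,
          (invSqrtCoeff (k + 1) - invSqrtCoeff k) * q h ^ (k + 1) := by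
      rw [Finset.mul_sum]
      refine Finset.sum_congr rfl fun k _ => ?_
      simp only [hq]
      rw [← pow_mul, div_pow, show 2 * (k + 1) = 2 * k + 1 + 1 by ring, pow_succ h, pow_succ b]
      have := hh.1
      field_simp
      ring
    rw [hsum]
    ring
  rw [hmain, correctionWeight, leadingWeight, mul_sub, Finset.mul_sum]
  have hsum2 : ∑ k ∈ Finset.range K, (invSqrtCoeff (k + 1) - invSqrtCoeff k + invSqrtCoeff k / 3) /
      b ^ (2 * k + 1) * h ^ (2 * k + 1) =
      (∑ k ∈ Finset.range K, (invSqrtCoeff (k + 1) - invSqrtCoeff k) / b ^ (2 * k + 1) *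
        h ^ (2 * k + 1)) +
      ∑ k ∈ Finset.range K, 1 / 3 * (invSqrtCoeff k / b ^ (2 * k + 1) * h ^ (2 * k + 1)) := by
    rw [← Finset.sum_add_distrib]
    exact Finset.sum_congr rfl fun k _ => by ring
  rw [hsum2]
  ring

/-- The weight is the nonnegative derivative of `-halfChord b`, which is continuous up to `b`; so
the inverse square root singularity there is integrable. -/
theorem integrableOn_leadingWeight {b : ℝ} (hb : 0 < b) :
    IntegrableOn (leadingWeight b) (Ioo 0 b) := by
  refine IntegrableOn.mono_set (intervalIntegral.integrableOn_deriv_of_nonneg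
    (g := fun h => -halfChord b h) (continuous_halfChord b).neg.continuousOn (fun h hh => ?_)
    fun h hh => div_nonneg hh.1.le (halfChord_nonneg b h)) Ioo_subset_Ioc_self
  refine (hasDerivAt_halfChord ⟨by linarith [hh.1], hh.2⟩).neg.congr_deriv ?_
  rw [leadingWeight]
  ring

theorem integral_leadingWeight {b : ℝ} (hb : 0 < b) :
    ∫ h in Ioo 0 b, leadingWeight b h = b := by
  rw [← integral_Ioc_eq_integral_Ioo, ← intervalIntegral.integral_of_le hb.le,
    intervalIntegral.integral_eq_sub_of_hasDerivAt_of_le (f := fun h => -halfChord b h) hb.le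
      (continuous_halfChord b).neg.continuousOn]
  · simp [halfChord, Real.sqrt_sq hb.le]
  · intro h hh
    refine (hasDerivAt_halfChord ⟨by linarith [hh.1], hh.2⟩).neg.congr_deriv ?_
    rw [leadingWeight]
    ring
  · rw [intervalIntegrable_iff_integrableOn_Ioo_of_le hb.le]
    exact integrableOn_leadingWeight hb

theorem integrableOn_correctionWeight {b : ℝ} (hb : 0 < b) :
    IntegrableOn (correctionWeight b) (Ioo 0 b) := by
  refine Integrable.add ?_ ((integrableOn_leadingWeight hb).div_const 3)
  refine Measure.integrableOn_of_bounded (M := 1) measure_Ioo_lt_top.ne ?_ ?_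
  · have := (continuous_halfChord b).measurable
    exact Measurable.aestronglyMeasurable (by fun_prop)
  · refine (ae_restrict_mem measurableSet_Ioo).mono fun h hh => ?_
    have h1 := halfChord_mem_Ioo hh
    have h2 := halfChord_sq (b := b) (ξ := h) ⟨by linarith [hh.1], hh.2.le⟩
    rw [Real.norm_eq_abs, abs_div, abs_of_pos hh.1, div_le_one hh.1, abs_le]
    constructor <;> nlinarith [hh.1, hh.2, h1.1, h1.2]

/-! ### Bounds for `1 - tanh` and `1 - tanh ^ 3` -/

theorem one_sub_tanh (x : ℝ) :
    1 - Real.tanh x = 2 * Real.exp (-(2 * x)) / (1 + Real.exp (-(2 * x))) := by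
  have h1 := Real.exp_pos x
  rw [Real.tanh_eq_sinh_div_cosh, Real.sinh_eq, Real.cosh_eq,
    show -(2 * x) = -x + -x by ring, Real.exp_add, Real.exp_neg]
  field_simp
  ring

theorem abs_one_sub_tanh_le (x : ℝ) : |1 - Real.tanh x| ≤ 2 * Real.exp (-(2 * x)) := by
  have h := Real.exp_pos (-(2 * x))
  rw [one_sub_tanh, abs_of_pos (by positivity)]
  exact div_le_self (by positivity) (by linarith)

theorem abs_one_sub_tanh_sub_le (x : ℝ) :
    |1 - Real.tanh x - 2 * Real.exp (-(2 * x))| ≤ 2 * Real.exp (-(4 * x)) := by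
  have h := Real.exp_pos (-(2 * x))
  rw [one_sub_tanh, show -(4 * x) = -(2 * x) + -(2 * x) by ring, Real.exp_add]
  generalize Real.exp (-(2 * x)) = q at *
  rw [show 2 * q / (1 + q) - 2 * q = -(2 * (q * q) / (1 + q)) by field_simp; ring, abs_neg,
    abs_of_pos (by positivity)]
  exact div_le_self (by positivity) (by linarith)

theorem abs_one_sub_tanh_pow_three_le {x : ℝ} (hx : 0 < x) :
    |1 - Real.tanh x ^ 3| ≤ 6 * Real.exp (-(2 * x)) := by
  have h1 := (abs_le.1 (abs_one_sub_tanh_le x)).2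
  have h2 := tanh_nonneg hx.le
  have h3 := tanh_le_one x
  rw [abs_of_nonneg (sub_nonneg.2 (pow_le_one₀ h2 h3)),
    show 1 - Real.tanh x ^ 3 =
      (1 - Real.tanh x) * (1 + Real.tanh x + Real.tanh x * Real.tanh x) by ring]
  have h4 : 1 + Real.tanh x + Real.tanh x * Real.tanh x ≤ 3 := by nlinarith
  calc _ ≤ (2 * Real.exp (-(2 * x))) * 3 := by
        refine mul_le_mul h1 h4 (by positivity) (by positivity)
    _ = _ := by ring

theorem abs_one_sub_tanh_pow_three_sub_le {x : ℝ} (hx : 0 < x) :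
    |1 - Real.tanh x ^ 3 - 6 * Real.exp (-(2 * x))| ≤ 26 * Real.exp (-(4 * x)) := by
  have h1 := abs_le.1 (abs_one_sub_tanh_le x)
  have h2 := abs_le.1 (abs_one_sub_tanh_sub_le x)
  have h3 := tanh_le_one x
  have h4 := tanh_nonneg hx.le
  have hq := Real.exp_pos (-(2 * x))
  rw [show -(4 * x) = -(2 * x) + -(2 * x) by ring, Real.exp_add] at h2 ⊢
  generalize Real.exp (-(2 * x)) = q at *
  -- With `r = 2q + O(q²)`, expand `1 - (1 - r)³ = 3r + O(r²)`. The constant `26` is not sharp.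
  obtain ⟨r, hr⟩ : ∃ r, r = 1 - Real.tanh x := ⟨_, rfl⟩
  have hr' : Real.tanh x = 1 - r := by linarith
  rw [hr'] at h1 h2 h3 h4 ⊢
  rw [sub_sub_cancel] at h1 h2
  have hr0 : 0 ≤ r := by linarith
  have hr1 : r ≤ 1 := by linarith
  have hr2 : r ^ 2 ≤ 4 * (q * q) := by nlinarith
  have hr3 : r ^ 3 ≤ r ^ 2 := by nlinarith [sq_nonneg r]
  have hr4 : 0 ≤ r ^ 3 := by positivity
  have e : 1 - (1 - r) ^ 3 = 3 * r - 3 * r ^ 2 + r ^ 3 := by ring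
  rw [e, abs_le]
  have hq2 : 0 ≤ q * q := by positivity
  constructor <;> linarith

/-! ### The logarithmic integral -/

/-- Beyond `1` replace `tanh³` by `1`: this gives the logarithm and a convergent integral. `κ`
collects the constants, and the remainder is a tail bounded by `∫ 6 e^{-2x}` over `x > y`, that is
`3 e^{-2y}`. -/
theorem exists_integral_tanh_pow_three_div :
    ∃ κ C : ℝ, ∀ y ≥ 1, |(∫ x in Ioo 0 y, Real.tanh x ^ 3 / x) - Real.log y - κ| ≤
      C * Real.exp (-(2 * y)) := by
  have hcT : Measurable Real.tanh := continuous_tanh.measurable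
  have hT : ∀ y, 0 ≤ y → IntegrableOn (fun x => Real.tanh x ^ 3 / x) (Ioc 0 y) := fun y _ => by
    refine Measure.integrableOn_of_bounded (M := 1) measure_Ioc_lt_top.ne
      (Measurable.aestronglyMeasurable (by fun_prop)) ?_
    refine (ae_restrict_mem measurableSet_Ioc).mono fun x hx => ?_
    have h1 := tanh_nonneg hx.1.le
    have h2 := tanh_le_one x
    have h3 := tanh_le_self hx.1.le
    rw [Real.norm_eq_abs, abs_of_nonneg (div_nonneg (by positivity) hx.1.le), div_le_one hx.1]
    exact (pow_le_of_le_one h1 h2 (by norm_num)).trans h3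
  have hbd : ∀ x ∈ Ioi (1 : ℝ), |(1 - Real.tanh x ^ 3) / x| ≤ 6 * Real.exp (-2 * x) :=
    fun x hx => by
      have hx1 : (1 : ℝ) < x := hx
      rw [abs_div, abs_of_pos (show (0 : ℝ) < x by linarith), neg_mul]
      refine (div_le_self (abs_nonneg _) hx1.le).trans (abs_one_sub_tanh_pow_three_le ?_)
      linarith
  have hexp : ∀ y, IntegrableOn (fun x : ℝ => 6 * Real.exp (-2 * x)) (Ioi y) := fun y =>
    (integrableOn_exp_mul_Ioi (by norm_num : (-2 : ℝ) < 0) y).const_mul 6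
  have hG : IntegrableOn (fun x => (1 - Real.tanh x ^ 3) / x) (Ioi 1) :=
    (hexp 1).mono' (Measurable.aestronglyMeasurable (by fun_prop))
      ((ae_restrict_mem measurableSet_Ioi).mono hbd)
  refine ⟨(∫ x in (0 : ℝ)..1, Real.tanh x ^ 3 / x) -
    ∫ x in Ioi (1 : ℝ), (1 - Real.tanh x ^ 3) / x, 3, fun y hy => ?_⟩
  have hy0 : (0 : ℝ) ≤ y := by linarith
  have hi : ∀ p q : ℝ, 0 ≤ p → p ≤ q →
      IntervalIntegrable (fun x => Real.tanh x ^ 3 / x) volume p q := fun p q hp hpq => by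
    rw [intervalIntegrable_iff_integrableOn_Ioc_of_le hpq]
    exact (hT q (hp.trans hpq)).mono_set (Ioc_subset_Ioc_left hp)
  have hGy : IntegrableOn (fun x => (1 - Real.tanh x ^ 3) / x) (Ioi y) :=
    hG.mono_set (Ioi_subset_Ioi hy)
  have e1 := intervalIntegral.integral_add_adjacent_intervals (hi 0 1 le_rfl zero_le_one)
    (hi 1 y zero_le_one hy)
  have e2 := intervalIntegral.integral_Ioi_sub_Ioi hG hy
  have hone : IntervalIntegrable (fun x : ℝ => 1 / x) volume 1 y := by
    refine ContinuousOn.intervalIntegrable (continuousOn_const.div continuousOn_id fun x hx => ?_)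
    rw [uIcc_of_le hy] at hx
    exact (zero_lt_one.trans_le hx.1).ne'
  have e3 : ∫ x in (1 : ℝ)..y, (1 - Real.tanh x ^ 3) / x =
      Real.log y - ∫ x in (1 : ℝ)..y, Real.tanh x ^ 3 / x := by
    simp only [sub_div]
    rw [intervalIntegral.integral_sub hone (hi 1 y zero_le_one hy),
      integral_one_div_of_pos one_pos (by linarith), div_one]
  have e4 : |∫ x in Ioi y, (1 - Real.tanh x ^ 3) / x| ≤ 3 * Real.exp (-(2 * y)) := by
    refine (norm_integral_le_of_norm_le (f := fun x => (1 - Real.tanh x ^ 3) / x) (hexp y) ((ae_restrict_mem measurableSet_Ioi).mono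
      fun x hx => hbd x (lt_of_le_of_lt hy hx))).trans_eq ?_
    rw [integral_const_mul, integral_exp_mul_Ioi (by norm_num)]
    ring_nf
  rw [← integral_Ioc_eq_integral_Ioo, ← intervalIntegral.integral_of_le hy0, ← e1]
  refine le_of_eq_of_le ?_ e4
  congr 1
  linarith

/-! ### The Weyl series of the two terms -/

/-- The higher Weyl coefficients of the leading term. -/
noncomputable def leadingCoeff (b : ℝ) (k : ℕ) : ℝ :=
  4 / (Real.pi * b ^ 2) *
    (invSqrtCoeff k / b ^ (2 * k + 1) * oddMoment (fun x => 1 - Real.tanh x) k)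

/-- The higher Weyl coefficients of the correction term. -/
noncomputable def correctionCoeff (b : ℝ) (k : ℕ) : ℝ :=
  2 / (Real.pi * b ^ 2) *
    ((invSqrtCoeff (k + 1) - invSqrtCoeff k + invSqrtCoeff k / 3) / b ^ (2 * k + 1) *
      oddMoment (fun x => 1 - Real.tanh x ^ 3) k)

theorem isBigO_inv_pow_mul (c : ℝ) {m n : ℕ} {f : ℝ → ℝ}
    (hf : f =O[atTop] fun s : ℝ => (s ^ n)⁻¹) :
    (fun s : ℝ => c / s ^ m * f s) =O[atTop] fun s : ℝ => (s ^ (m + n))⁻¹ := by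
  have h := ((isBigO_refl (fun s : ℝ => (s ^ m)⁻¹) atTop).const_mul_left c).mul hf
  refine (h.congr_left fun s => by rw [div_eq_mul_inv]).congr_right fun s => ?_
  rw [pow_add, mul_inv]

theorem hasWeylSeries_leadingTerm {b : ℝ} (hb : 0 < b) :
    HasWeylSeries (leadingTerm b) (oddWeylCoeff 1 (-(4 / (Real.pi * b))) (leadingCoeff b)) := by
  refine hasWeylSeries_oddWeylCoeff fun K => ?_
  have hG : Continuous fun x => 1 - Real.tanh x := continuous_const.sub continuous_tanh
  have hW := isBigO_watson hb (integrableOn_leadingWeight hb) hG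
    (fun x _ => abs_one_sub_tanh_le x) K (isBigO_leadingWeight hb K)
  have h := isBigO_inv_pow_mul (4 / (Real.pi * b ^ 2)) (m := 3) hW
  rw [show 3 + (2 * K + 2) = 2 * K + 5 by ring] at h
  refine h.congr' ?_ EventuallyEq.rfl
  filter_upwards [eventually_gt_atTop 0] with s hs
  have hi := integrableOn_mul_comp_mul (s := s) (M := 2) (integrableOn_leadingWeight hb) hG
    fun h hh => (abs_one_sub_tanh_le _).trans (by
      have : Real.exp (-(2 * (s * h))) ≤ 1 := Real.exp_le_one_iff.2 (by
        have := mul_pos hs hh.1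
        linarith)
      linarith)
  -- The total mass `b` of the weight gives the `1 / s³` term; Watson's lemma applies to the rest.
  have e1 : ∫ h in Ioo 0 b, h / halfChord b h * Real.tanh (s * h) =
      b - ∫ h in Ioo 0 b, leadingWeight b h * (1 - Real.tanh (s * h)) := by
    refine Eq.trans ?_ (congrArg (· - _) (integral_leadingWeight hb))
    rw [← integral_sub (integrableOn_leadingWeight hb) hi]
    refine setIntegral_congr_fun measurableSet_Ioo fun h _ => ?_
    simp only [leadingWeight]
    ring
  rw [leadingTerm_eq hb, e1]
  have e2 : ∑ k ∈ Finset.range K, leadingCoeff b k / s ^ (2 * k + 5) =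
      4 / (Real.pi * b ^ 2) / s ^ 3 * ∑ k ∈ Finset.range K,
        invSqrtCoeff k / b ^ (2 * k + 1) * oddMoment (fun x => 1 - Real.tanh x) k /
          s ^ (2 * k + 2) := by
    rw [Finset.mul_sum]
    refine Finset.sum_congr rfl fun k _ => ?_
    rw [leadingCoeff, show 2 * k + 5 = 3 + (2 * k + 2) by ring, pow_add s 3]
    have := Real.pi_pos
    field_simp
  rw [e2]
  generalize (∑ k ∈ Finset.range K, invSqrtCoeff k / b ^ (2 * k + 1) *
    oddMoment (fun x => 1 - Real.tanh x) k / s ^ (2 * k + 2)) = S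
  generalize (∫ h in Ioo 0 b, leadingWeight b h * (1 - Real.tanh (s * h))) = I
  have := Real.pi_pos
  field_simp
  ring

theorem isBigO_exp_neg_inv_pow {b : ℝ} (hb : 0 < b) (n : ℕ) :
    (fun s : ℝ => Real.exp (-(2 * (s * b)))) =O[atTop] fun s : ℝ => (s ^ n)⁻¹ := by
  refine IsBigO.of_bound (n.factorial / (2 * b) ^ n) ?_
  filter_upwards [eventually_gt_atTop 0] with s hs
  have h1 := Real.pow_div_factorial_le_exp (2 * (s * b)) (by positivity) n
  rw [Real.norm_of_nonneg (Real.exp_pos _).le, Real.norm_of_nonneg (by positivity), Real.exp_neg,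
    inv_le_comm₀ (Real.exp_pos _) (by positivity)]
  refine le_of_eq_of_le ?_ h1
  rw [mul_inv, inv_inv, inv_div, show 2 * (s * b) = 2 * b * s by ring, mul_pow (2 * b) s]
  ring

theorem setIntegral_tanh_pow_three_div {b s : ℝ} (hb : 0 < b) (hs : 0 < s) :
    ∫ h in Ioo 0 b, Real.tanh (s * h) ^ 3 / h = ∫ x in Ioo 0 (s * b), Real.tanh x ^ 3 / x := by
  have h := intervalIntegral.integral_comp_mul_left (a := 0) (b := b)
    (fun x => Real.tanh x ^ 3 / x) hs.ne'
  rw [mul_zero, intervalIntegral.integral_of_le hb.le,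
    intervalIntegral.integral_of_le (by positivity), integral_Ioc_eq_integral_Ioo,
    integral_Ioc_eq_integral_Ioo, smul_eq_mul, eq_inv_mul_iff_mul_eq₀ hs.ne',
    ← integral_const_mul] at h
  rw [← h]
  refine setIntegral_congr_fun measurableSet_Ioo fun x hx => ?_
  have := hx.1
  field_simp

/-- The part `b / h` of the weight, after scaling by `s`, contributes `b (log (s b) + κ)` with
exponentially small error, hence no further powers. The regular part yields the constant `J` and the
Watson series. -/
theorem exists_hasWeylSeries_correctionTerm {b : ℝ} (hb : 0 < b) :
    ∃ c₃, HasWeylSeries (fun s => correctionTerm b s + 2 / (Real.pi * b) * (Real.log s / s ^ 3))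
      (oddWeylCoeff 0 c₃ (correctionCoeff b)) := by
  obtain ⟨κ, C, hκ⟩ := exists_integral_tanh_pow_three_div
  set J := ∫ h in Ioo 0 b, correctionWeight b h with hJ
  refine ⟨-(2 / (Real.pi * b ^ 2) * (b * (Real.log b + κ) + J)),
    hasWeylSeries_oddWeylCoeff fun K => ?_⟩
  have hG : Continuous fun x => 1 - Real.tanh x ^ 3 := continuous_const.sub (continuous_tanh.pow 3)
  have hW := isBigO_watson hb (integrableOn_correctionWeight hb) hG
    (fun x hx => abs_one_sub_tanh_pow_three_le hx) K (isBigO_correctionWeight hb K)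
  have hE : (fun s => (∫ x in Ioo 0 (s * b), Real.tanh x ^ 3 / x) - Real.log (s * b) - κ)
      =O[atTop] fun s : ℝ => (s ^ (2 * K + 2))⁻¹ := by
    refine (IsBigO.of_bound C ?_).trans (isBigO_exp_neg_inv_pow hb (2 * K + 2))
    filter_upwards [eventually_ge_atTop (1 / b)] with s hs
    rw [Real.norm_of_nonneg (Real.exp_pos _).le]
    exact hκ _ (by rwa [ge_iff_le, ← div_le_iff₀ hb])
  have h := isBigO_inv_pow_mul (2 / (Real.pi * b ^ 2)) (m := 3)
    (hW.sub (hE.const_mul_left b))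
  rw [show 3 + (2 * K + 2) = 2 * K + 5 by ring] at h
  refine h.congr' ?_ EventuallyEq.rfl
  filter_upwards [eventually_gt_atTop 0] with s hs
  have hi := integrableOn_mul_comp_mul (s := s) (M := 6) (integrableOn_correctionWeight hb) hG
    fun h hh => (abs_one_sub_tanh_pow_three_le (mul_pos hs hh.1)).trans (by
      have : Real.exp (-(2 * (s * h))) ≤ 1 := Real.exp_le_one_iff.2 (by
        have := mul_pos hs hh.1
        linarith)
      linarith)
  have hi2 : IntegrableOn (fun h => Real.tanh (s * h) ^ 3 / h) (Ioo 0 b) := by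
    have hm : Measurable Real.tanh := continuous_tanh.measurable
    refine Measure.integrableOn_of_bounded (M := s) measure_Ioo_lt_top.ne
      (Measurable.aestronglyMeasurable (by fun_prop)) ?_
    refine (ae_restrict_mem measurableSet_Ioo).mono fun x hx => ?_
    have hsx := mul_pos hs hx.1
    have h1 := tanh_nonneg hsx.le
    have h2 := tanh_le_one (s * x)
    have h3 := tanh_le_self hsx.le
    rw [Real.norm_eq_abs, abs_of_nonneg (div_nonneg (by positivity) hx.1.le), div_le_iff₀ hx.1]
    exact (pow_le_of_le_one h1 h2 (by norm_num)).trans h3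
  have e1 : ∫ h in Ioo 0 b, (halfChord b h / h + h / halfChord b h / 3) * Real.tanh (s * h) ^ 3 =
      b * (∫ x in Ioo 0 (s * b), Real.tanh x ^ 3 / x) +
        (J - ∫ h in Ioo 0 b, correctionWeight b h * (1 - Real.tanh (s * h) ^ 3)) := by
    have hsub : IntegrableOn (fun h => correctionWeight b h -
        correctionWeight b h * (1 - Real.tanh (s * h) ^ 3)) (Ioo 0 b) :=
      (integrableOn_correctionWeight hb).sub hi
    rw [← setIntegral_tanh_pow_three_div hb hs, hJ,
      ← integral_sub (integrableOn_correctionWeight hb) hi, ← integral_const_mul,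
      ← integral_add (hi2.const_mul b) hsub]
    refine setIntegral_congr_fun measurableSet_Ioo fun h _ => ?_
    simp only [correctionWeight]
    ring
  rw [correctionTerm_eq hb hs, e1, Real.log_mul hs.ne' hb.ne']
  have e2 : ∑ k ∈ Finset.range K, correctionCoeff b k / s ^ (2 * k + 5) =
      2 / (Real.pi * b ^ 2) / s ^ 3 * ∑ k ∈ Finset.range K,
        (invSqrtCoeff (k + 1) - invSqrtCoeff k + invSqrtCoeff k / 3) / b ^ (2 * k + 1) *
          oddMoment (fun x => 1 - Real.tanh x ^ 3) k / s ^ (2 * k + 2) := by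
    rw [Finset.mul_sum]
    refine Finset.sum_congr rfl fun k _ => ?_
    rw [correctionCoeff, show 2 * k + 5 = 3 + (2 * k + 2) by ring, pow_add s 3]
    have := Real.pi_pos
    field_simp
  rw [e2]
  generalize (∑ k ∈ Finset.range K, (invSqrtCoeff (k + 1) - invSqrtCoeff k + invSqrtCoeff k / 3) /
    b ^ (2 * k + 1) * oddMoment (fun x => 1 - Real.tanh x ^ 3) k / s ^ (2 * k + 2)) = S
  generalize (∫ h in Ioo 0 b, correctionWeight b h * (1 - Real.tanh (s * h) ^ 3)) = I
  generalize (∫ x in Ioo 0 (s * b), Real.tanh x ^ 3 / x) = L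
  have := Real.pi_pos
  field_simp
  ring

/-! ### High orders -/

/-- Log-convexity at the midpoints of `x, x + 1` and of `x + 1/2, x + 3/2` squeezes the squared
ratio between `x / (x + 1/2)` and `1`. -/
theorem tendsto_Gamma_add_half_div :
    Tendsto (fun x : ℝ => Real.Gamma (x + 1 / 2) / (√x * Real.Gamma x)) atTop (𝓝 1) := by
  have hmid : ∀ s t : ℝ, 0 < s → 0 < t →
      Real.Gamma ((s + t) / 2) ^ 2 ≤ Real.Gamma s * Real.Gamma t := fun s t hs ht => by
    have h := Real.Gamma_mul_add_mul_le_rpow_Gamma_mul_rpow_Gamma hs ht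
      (show (0 : ℝ) < 1 / 2 by norm_num) (show (0 : ℝ) < 1 / 2 by norm_num) (by norm_num)
    rw [← Real.sqrt_eq_rpow, ← Real.sqrt_eq_rpow, show 1 / 2 * s + 1 / 2 * t = (s + t) / 2 by ring]
      at h
    have h1 := Real.Gamma_pos_of_pos hs
    have h2 := Real.Gamma_pos_of_pos ht
    have h3 := Real.Gamma_pos_of_pos (show 0 < (s + t) / 2 by positivity)
    calc _ ≤ (√(Real.Gamma s) * √(Real.Gamma t)) ^ 2 := by gcongr
      _ = _ := by rw [mul_pow, Real.sq_sqrt h1.le, Real.sq_sqrt h2.le]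
  have hsq : Tendsto (fun x : ℝ => (Real.Gamma (x + 1 / 2) / (√x * Real.Gamma x)) ^ 2) atTop
      (𝓝 1) := by
    have hlow : Tendsto (fun x : ℝ => 1 - 1 / 2 / (x + 1 / 2)) atTop (𝓝 1) := by
      have : Tendsto (fun x : ℝ => 1 / 2 / (x + 1 / 2)) atTop (𝓝 0) :=
        (tendsto_atTop_add_const_right atTop (1 / 2 : ℝ) tendsto_id).const_div_atTop (1 / 2)
      simpa using this.const_sub 1
    refine tendsto_of_tendsto_of_tendsto_of_le_of_le' hlow tendsto_const_nhds ?_ ?_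
    · filter_upwards [eventually_gt_atTop 0] with x hx
      have hg := Real.Gamma_pos_of_pos hx
      have h := hmid (x + 1 / 2) (x + 3 / 2) (by positivity) (by positivity)
      rw [show (x + 1 / 2 + (x + 3 / 2)) / 2 = x + 1 by ring,
        show x + 3 / 2 = x + 1 / 2 + 1 by ring, Real.Gamma_add_one hx.ne',
        Real.Gamma_add_one (by positivity)] at h
      rw [div_pow, mul_pow, Real.sq_sqrt hx.le, le_div_iff₀ (by positivity),
        show 1 - 1 / 2 / (x + 1 / 2) = x / (x + 1 / 2) by field_simp; ring, div_mul_eq_mul_div,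
        div_le_iff₀ (by positivity)]
      linarith
    · filter_upwards [eventually_gt_atTop 0] with x hx
      have hg := Real.Gamma_pos_of_pos hx
      have h := hmid x (x + 1) hx (by positivity)
      rw [show (x + (x + 1)) / 2 = x + 1 / 2 by ring, Real.Gamma_add_one hx.ne'] at h
      rw [div_pow, mul_pow, Real.sq_sqrt hx.le, div_le_one (by positivity)]
      linarith
  have h := hsq.sqrt
  rw [Real.sqrt_one] at h
  refine h.congr' ?_
  filter_upwards [eventually_gt_atTop 0] with x hx
  have h1 := Real.Gamma_pos_of_pos hx
  have h2 := Real.Gamma_pos_of_pos (show 0 < x + 1 / 2 by positivity)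
  rw [Real.sqrt_sq (by positivity)]

/-- Both sides are the rising factorial of `1/2` divided by `k!`, by the recursion for `Γ`. -/
theorem invSqrtCoeff_eq (k : ℕ) :
    invSqrtCoeff k = Real.Gamma (k + 1 / 2) / (√Real.pi * Real.Gamma (k + 1)) := by
  have h1 : (k.factorial : ℝ) * invSqrtCoeff k = (ascPochhammer ℝ k).eval (1 / 2) := by
    rw [← Polynomial.ascPochhammer_smeval_eq_eval,
      ← Ring.factorial_nsmul_multichoose_eq_ascPochhammer, invSqrtCoeff, Ring.choose,
      nsmul_eq_mul]
    congr 2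
    ring
  have h2 : ∀ k : ℕ, Real.Gamma (k + 1 / 2) = (ascPochhammer ℝ k).eval (1 / 2) * √Real.pi := by
    intro k
    induction k with
    | zero => simpa using Real.Gamma_one_half_eq
    | succ k ih =>
      have hpos : (k : ℝ) + 1 / 2 ≠ 0 := by positivity
      rw [ascPochhammer_succ_eval, Nat.cast_succ, add_right_comm, Real.Gamma_add_one hpos, ih]
      ring
  have h3 : (k.factorial : ℝ) ≠ 0 := by positivity
  have h4 : √Real.pi ≠ 0 := by
    have := Real.pi_pos
    positivity
  rw [h2, ← h1, Real.Gamma_nat_eq_factorial]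
  field_simp

theorem invSqrtCoeff_succ (k : ℕ) :
    invSqrtCoeff (k + 1) = invSqrtCoeff k * (1 - 1 / (2 * (k + 1))) := by
  have h1 := Real.Gamma_pos_of_pos (show (0 : ℝ) < k + 1 by positivity)
  have := Real.pi_pos
  have h2 : (k : ℝ) + 1 / 2 ≠ 0 := by positivity
  have h3 : (k : ℝ) + 1 ≠ 0 := by positivity
  rw [invSqrtCoeff_eq, invSqrtCoeff_eq, Nat.cast_succ, add_right_comm, Real.Gamma_add_one h2,
    Real.Gamma_add_one h3]
  field_simp
  ring

/-- Two half-step ratios of `Γ`, at `k + 1/2` and `2k + 3/2`, leave `√(2k + 3/2) / √(π (k + 1/2))`.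
This is how the binomial decay lowers the argument of `Γ` by one half. -/
theorem tendsto_invSqrtCoeff_mul_Gamma :
    Tendsto (fun k : ℕ => invSqrtCoeff k * ((2 * k + 1).factorial / Real.Gamma (2 * k + 3 / 2)))
      atTop (𝓝 √(2 / Real.pi)) := by
  have hn : Tendsto (fun k : ℕ => (k : ℝ)) atTop atTop := tendsto_natCast_atTop_atTop
  have h1 := tendsto_Gamma_add_half_div.comp
    (tendsto_atTop_add_const_right atTop (1 / 2 : ℝ) hn)
  have h2 := tendsto_Gamma_add_half_div.comp
    (tendsto_atTop_add_const_right atTop (3 / 2 : ℝ) (hn.const_mul_atTop (zero_lt_two' ℝ)))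
  have h3 : Tendsto (fun k : ℕ => √((2 + 1 / 2 / ((k : ℝ) + 1 / 2)) / Real.pi)) atTop
      (𝓝 √((2 + 0) / Real.pi)) :=
    ((((tendsto_atTop_add_const_right atTop (1 / 2 : ℝ) hn).const_div_atTop
      (1 / 2)).const_add 2).div_const _).sqrt
  have h := (h2.div h1 one_ne_zero).mul h3
  rw [div_one, one_mul, add_zero] at h
  refine h.congr fun k => ?_
  have hpi := Real.pi_pos
  have g1 := Real.Gamma_pos_of_pos (show (0 : ℝ) < k + 1 / 2 by positivity)
  have g2 := Real.Gamma_pos_of_pos (show (0 : ℝ) < k + 1 by positivity)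
  have g3 := Real.Gamma_pos_of_pos (show (0 : ℝ) < 2 * k + 3 / 2 by positivity)
  have e1 : ((2 * k + 1).factorial : ℝ) = Real.Gamma (2 * k + 3 / 2 + 1 / 2) := by
    rw [← Real.Gamma_nat_eq_factorial]
    congr 1
    push_cast
    ring
  have e2 : (k : ℝ) + 1 / 2 + 1 / 2 = k + 1 := by ring
  have e3 : (2 + 1 / 2 / ((k : ℝ) + 1 / 2)) / Real.pi =
      (2 * k + 3 / 2) / (((k : ℝ) + 1 / 2) * Real.pi) := by
    field_simp
    ring
  simp only [Pi.div_apply, Function.comp_apply]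
  rw [e3, e1, e2, invSqrtCoeff_eq, Real.sqrt_div (by positivity), Real.sqrt_mul (by positivity)]
  have s1 : 0 < √((k : ℝ) + 1 / 2) := Real.sqrt_pos.2 (by positivity)
  have s2 : 0 < √(2 * (k : ℝ) + 3 / 2) := Real.sqrt_pos.2 (by positivity)
  have s3 : 0 < √Real.pi := Real.sqrt_pos.2 hpi
  field_simp

/-- The leading exponential gives exactly `κ (2k+1)! / 2^(2k+2)`; the `e^{-4x}` remainder is smaller
by `2^{-(2k+2)} = (1/4)^(k+1)`. -/
theorem tendsto_oddMoment_div {G : ℝ → ℝ} {κ B C : ℝ} (hG : Continuous G)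
    (hGle : ∀ x > 0, |G x| ≤ B * Real.exp (-(2 * x)))
    (hGsub : ∀ x > 0, |G x - κ * Real.exp (-(2 * x))| ≤ C * Real.exp (-(4 * x))) :
    Tendsto (fun k => oddMoment G k / ((2 * k + 1).factorial / 2 ^ (2 * k + 2))) atTop
      (𝓝 κ) := by
  have hbound : ∀ k : ℕ, |oddMoment G k / ((2 * k + 1).factorial / 2 ^ (2 * k + 2)) - κ| ≤
      C * (1 / 4) ^ (k + 1) := by
    intro k
    have hi1 : IntegrableOn (fun x => x ^ (2 * k + 1) * G x) (Ioi 0) := by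
      simpa using integrableOn_pow_mul_comp_mul one_pos hG hGle (2 * k + 1)
    have hi2 := integrableOn_pow_mul_exp_neg (2 * k + 1) (c := 2) two_pos
    have hi4 := integrableOn_pow_mul_exp_neg (2 * k + 1) (c := 4) four_pos
    have e1 : oddMoment G k - κ * ((2 * k + 1).factorial / 2 ^ (2 * k + 2)) =
        ∫ x in Ioi (0 : ℝ), (x ^ (2 * k + 1) * G x -
          κ * (x ^ (2 * k + 1) * Real.exp (-(2 * x)))) := by
      rw [integral_sub hi1 (hi2.const_mul κ), integral_const_mul,
        integral_pow_mul_exp_neg _ two_pos, oddMoment]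
    have e2 : |oddMoment G k - κ * ((2 * k + 1).factorial / 2 ^ (2 * k + 2))| ≤
        C * ((2 * k + 1).factorial / 4 ^ (2 * k + 2)) := by
      rw [e1, ← integral_pow_mul_exp_neg (2 * k + 1) (four_pos (α := ℝ)), ← integral_const_mul]
      refine norm_integral_le_of_norm_le (f := fun x => x ^ (2 * k + 1) * G x -
        κ * (x ^ (2 * k + 1) * Real.exp (-(2 * x)))) (hi4.const_mul C)
        ((ae_restrict_mem measurableSet_Ioi).mono fun x hx => ?_)
      have hx : 0 < x := hx
      rw [mul_left_comm κ, ← mul_sub, norm_mul, Real.norm_eq_abs, Real.norm_eq_abs,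
        abs_of_pos (by positivity), mul_left_comm C]
      gcongr
      exact hGsub x hx
    have hpos : (0 : ℝ) < (2 * k + 1).factorial / 2 ^ (2 * k + 2) := by positivity
    rw [div_sub' hpos.ne', abs_div, abs_of_pos hpos, div_le_iff₀ hpos, mul_comm _ κ]
    refine e2.trans_eq ?_
    rw [show (4 : ℝ) ^ (2 * k + 2) = 4 ^ (k + 1) * 2 ^ (2 * k + 2) by
      rw [show 2 * k + 2 = 2 * (k + 1) by ring, pow_mul 2, pow_mul 4, ← mul_pow]; norm_num,
      one_div, inv_pow]
    field_simp
  rw [tendsto_iff_norm_sub_tendsto_zero]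
  refine squeeze_zero (fun _ => norm_nonneg _) hbound ?_
  have h := ((tendsto_pow_atTop_nhds_zero_of_lt_one (show (0 : ℝ) ≤ 1 / 4 by norm_num)
    (by norm_num)).comp (tendsto_add_atTop_nat 1)).const_mul C
  simpa using h

/-- High orders of coefficients built from `invSqrtCoeff` and odd moments. -/
theorem isEquivalent_weylHighOrder {b p κ c₂ c₃ α : ℝ} (hb : 0 < b) (hα : 0 < α) {r d : ℕ → ℝ}
    {ρ : ℝ} {G : ℝ → ℝ}
    (hd : ∀ k, d k = p / (Real.pi * b ^ 2) *
      (r k * invSqrtCoeff k / b ^ (2 * k + 1) * oddMoment G k))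
    (hr : Tendsto r atTop (𝓝 ρ))
    (hm : Tendsto (fun k => oddMoment G k / ((2 * k + 1).factorial / 2 ^ (2 * k + 2))) atTop
      (𝓝 κ))
    (hval : 2 * p / Real.pi * ρ * κ * √(2 / Real.pi) = α) :
    (fun k : ℕ => oddWeylCoeff c₂ c₃ d (2 * k + 1)) ~[atTop] fun k : ℕ =>
      weylHighOrder α (9 / 2) (2 * b) (2 * k + 1) := by
  have hg : ∀ k : ℕ, weylHighOrder α (9 / 2) (2 * b) (2 * (k + 2) + 1) =
      α * Real.Gamma (2 * k + 3 / 2) / (2 * b) ^ (2 * k + 3) := fun k => by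
    rw [weylHighOrder, ← zpow_natCast (2 * b) (2 * k + 3)]
    congr 2
    · congr 1
      push_cast
      ring
    · push_cast
      ring
  have hgpos : ∀ k : ℕ, 0 < Real.Gamma (2 * k + 3 / 2) := fun k =>
    Real.Gamma_pos_of_pos (by positivity)
  rw [isEquivalent_iff_tendsto_one]
  -- The shift matches indices: `d k` sits at `n = 2k + 5`, where `n - 9/2 + 1 = 2k + 3/2`. The base
  -- `2^(2k+3)` against `2^(2k+2)` in the moment explains the factor `2` in `hval`.
  · rw [← tendsto_add_atTop_iff_nat 2]
    have h := ((hr.const_mul (2 * p / Real.pi)).mul hm).mul tendsto_invSqrtCoeff_mul_Gamma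
    rw [hval] at h
    have h' := h.div_const α
    rw [div_self hα.ne'] at h'
    refine h'.congr fun k => ?_
    simp only [Pi.div_apply]
    rw [hg, show 2 * (k + 2) + 1 = 2 * k + 5 by ring, oddWeylCoeff_odd, hd]
    have h1 := hgpos k
    have h2 : (0 : ℝ) < (2 * k + 1).factorial := by positivity
    have hpi := Real.pi_pos
    rw [show 2 * k + 3 = (2 * k + 1) + 2 by ring, mul_pow, pow_add b, show 2 * k + 1 + 2 =
      2 * k + 2 + 1 by ring, pow_succ 2]
    field_simp
    ring
  · filter_upwards [eventually_ge_atTop 2] with k hk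
    obtain ⟨j, rfl⟩ := Nat.exists_eq_add_of_le' hk
    rw [hg]
    have := hgpos j
    positivity

theorem sqrt_two_div_pi_pow_three :
    √(2 / Real.pi ^ 3) = √(2 / Real.pi) / Real.pi := by
  have := Real.pi_pos
  rw [show 2 / Real.pi ^ 3 = 2 / Real.pi / Real.pi ^ 2 by field_simp,
    Real.sqrt_div (by positivity), Real.sqrt_sq this.le]

theorem mainTheorem5 (b : ℝ) (hb : 0 < b) :
    ∃ (H₀ H₁ : ℝ → ℝ) (c₀ c₁ : ℕ → ℝ),
      -- first-order expansion in `lam = 1 - ε ^ 2 = (b / a) ^ 2`, at every fixed `s`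
      (∀ u : ℝ → ℝ → Plane → ℝ,
        (∀ lam ∈ Ioo (0 : ℝ) 1,
          IsLocalHeatContent (ellipseDomain (b / Real.sqrt lam) b) (u lam)) →
        ∀ s > 0,
          (fun lam : ℝ =>
            laplaceHeatContent (ellipseDomain (b / Real.sqrt lam) b) (u lam) s
              - (H₀ s + lam * H₁ s)) =O[𝓝[>] 0] fun lam : ℝ => lam ^ 2) ∧
      -- Weyl series of the two terms
      HasWeylSeries H₀ c₀ ∧
      HasWeylSeries (fun s => H₁ s + 2 / (Real.pi * b) * (Real.log s / s ^ 3)) c₁ ∧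
      -- besides the `1 / s ^ 2` term, only odd powers of `1 / s` occur
      c₀ 2 = 1 ∧ c₁ 2 = 0 ∧
      (∀ n, 4 ≤ n → Even n → c₀ n = 0 ∧ c₁ n = 0) ∧
      -- high orders, along the odd `n = 2 k + 1`, with `β = 9 / 2` and `l = 2 b`
      ((fun k : ℕ => c₀ (2 * k + 1)) ~[atTop] fun k : ℕ =>
        weylHighOrder (16 * Real.sqrt (2 / Real.pi ^ 3)) (9 / 2) (2 * b) (2 * k + 1)) ∧
      ((fun k : ℕ => c₁ (2 * k + 1)) ~[atTop] fun k : ℕ =>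
        weylHighOrder (1 / 2 * (16 * Real.sqrt (2 / Real.pi ^ 3))) (9 / 2) (2 * b)
          (2 * k + 1)) := by
  obtain ⟨c₃, hc₃⟩ := exists_hasWeylSeries_correctionTerm hb
  have hpi := Real.pi_pos
  have hα : 0 < 16 * √(2 / Real.pi ^ 3) := by positivity
  refine ⟨leadingTerm b, correctionTerm b, _, _, ?_, hasWeylSeries_leadingTerm hb, hc₃,
    by simp [oddWeylCoeff], by simp [oddWeylCoeff],
    fun n hn he => ⟨oddWeylCoeff_even _ _ _ hn he, oddWeylCoeff_even _ _ _ hn he⟩, ?_, ?_⟩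
  · intro u hu s hs
    -- The constant depends on `b` and `s` only, so it is uniform in `λ` and in the choice of `u`.
    obtain ⟨C, hC⟩ := exists_abs_laplaceHeatContent_sub_average_approxSolution_le hb hs
    refine IsBigO.of_bound C ?_
    filter_upwards [Ioo_mem_nhdsGT (show (0 : ℝ) < 1 by norm_num)] with lam hlam
    have h := hC lam hlam (u lam) (hu lam hlam)
    rw [average_approxSolution hb hs hlam.1] at h
    rwa [Real.norm_eq_abs, Real.norm_of_nonneg (sq_nonneg lam)]
  · refine isEquivalent_weylHighOrder (p := 4) (r := fun _ => 1) (ρ := 1) (κ := 2)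
      (G := fun x => 1 - Real.tanh x) hb hα (fun k => ?_) tendsto_const_nhds
      (tendsto_oddMoment_div (continuous_const.sub continuous_tanh)
        (fun x _ => abs_one_sub_tanh_le x) fun x _ => abs_one_sub_tanh_sub_le x) ?_
    · rw [leadingCoeff, one_mul]
    · rw [sqrt_two_div_pi_pow_three]
      ring
  -- `r k` is the relative size of the second weight's coefficient, `(a_{k+1} - a_k + a_k / 3) /
  -- a_k` for `a = invSqrtCoeff`; `κ = 6` is the leading amplitude of `1 - tanh³`.
  · refine isEquivalent_weylHighOrder (p := 2)
      (r := fun k : ℕ => 1 / 3 - 1 / (2 * ((k : ℝ) + 1))) (ρ := 1 / 3) (κ := 6)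
      (G := fun x => 1 - Real.tanh x ^ 3) hb (by positivity) (fun k => ?_) ?_
      (tendsto_oddMoment_div (continuous_const.sub (continuous_tanh.pow 3))
        (fun x hx => abs_one_sub_tanh_pow_three_le hx)
        fun x hx => abs_one_sub_tanh_pow_three_sub_le hx) ?_
    · rw [correctionCoeff, invSqrtCoeff_succ]
      ring
    · have h : Tendsto (fun k : ℕ => 1 / (2 * ((k : ℝ) + 1))) atTop (𝓝 0) :=
        ((tendsto_atTop_add_const_right atTop (1 : ℝ)
          tendsto_natCast_atTop_atTop).const_mul_atTop (zero_lt_two' ℝ)).const_div_atTop 1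
      have h' := h.const_sub (1 / 3 : ℝ)
      rwa [sub_zero] at h'
    · rw [sqrt_two_div_pi_pow_three]
      ring
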